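/- **Theorem.** Let $\mathcal X$ be a measurable space, $\mathcal F$ a class of functions $\mathcal X\to\{0,1\}$ of VC dimension $d$, and $D_1,\dots,D_k$ ($k\ge 1$) probability distributions on $\mathcal X\times\{0,1\}$; write $\mathrm{err}_D(f)=\Pr_{(x,y)\sim D}[f(x)\ne y]$, and for a finite sample $S$ let $\mathrm{err}_S(f)$ be the fraction of the examples of $S$ that $f$ mislabels. Assume realizability: some $f^*\in\mathcal F$ has $\mathrm{err}_{D_i}(f^*)=0$ for all $i\in[k]$. Let $\mathcal O_{\mathcal F}$ be an empirical risk minimizer: for every finite sample $S$ it returns a member of $\mathcal F$ of minimal error on $S$, and $(S,x)\mapsto \mathcal O_{\mathcal F}(S)(x)$ is measurable for each sample size. For $\epsilon,\delta\in(0,1)$ and constants $C_1,C_2$, Algorithm R2 is the following. Put $t=150\lceil\log_2(k/\delta)\rceil$, $\epsilon'=\epsilon/6$, $\delta'=\delta/(4t)$, and $w_i^{(0)}=1$ for $i\in[k]$. In round $r=1,\dots,t$: 1. draw a sample $S^{(r)}$ of $m_{\epsilon'/16,\delta'}$ independent examples from the mixture $\tilde D^{(r-1)}=\sum_i w_i^{(r-1)}D_i\big/\sum_i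 w_i^{(r-1)}$, where $m_{a,b}=\big\lceil \frac{C_1}{a}\big(d\ln\frac1a+\ln\frac1b\big)\big\rceil$, and put $f^{(r)}=\mathcal O_{\mathcal F}(S^{(r)})$; 2. (FastTest) draw, for each $i\in[k]$, a fresh sample $T_i$ of $\lceil C_2/\epsilon'\rceil$ independent examples from $D_i$, and let $G_r=\{i : \mathrm{err}_{T_i}(f^{(r)})\le \frac34\epsilon'\}$; 3. set $w_i^{(r)}=2w_i^{(r-1)}$ if $i\notin G_r$, and $w_i^{(r)}=w_i^{(r-1)}$ otherwise. Return the pointwise majority vote $f_{\mathrm{R2}}$ of $f^{(1)},\dots,f^{(t)}$ (label $0$ in case of a tie). There is an absolute constant $C_0>0$ such that, whenever $C_1\ge C_0$ and $C_2\ge 148$, the following hold. (i) For all $\mathcal X$, $\mathcal F$, $d$, $k$, $D_1,\dots,D_k$, $\mathcal O_{\mathcal F}$ as above and all $\epsilon,\delta\in(0,1)$, with probability at least $1-\delta$ the classifier returned by Algorithm R2 satisfies $\mathrm{err}_{D_i}(f_{\mathrm{R2}})\le\epsilon$ for all $i\in[k]$. (ii) The total number $m=t\,\big(m_{\epsilon'/16,\delta'}+k\lceil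 C_2/\epsilon'\rceil\big)$ of examples drawn satisfies $$m=O\Big(\frac1\epsilon\ln\Big(\frac k\delta\Big)\Big(d\ln\Big(\frac1\epsilon\Big)+k+\ln\Big(\frac1\delta\Big)\Big)\Big)$$ in the following sense: for every $\eta\in(0,1)$ there is a constant $C>0$, depending only on $\eta,C_1,C_2$, such that $m$ is at most $C$ times the expression inside the $O(\cdot)$ for all $d\ge 0$, $k\ge1$, and $\epsilon,\delta\in(0,1)$ with $\epsilon\le\eta$ and $\delta/k\le\eta$. -/

import Mathlib

open MeasureTheory
open scoped ENNReal

noncomputable section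

namespace CollabPAC

/-! ### Classifiers, errors, VC dimension, empirical risk minimization -/

/-- An (ordered) sample of `n` labelled examples. The label set `{0, 1}` is `Bool`. -/
abbrev Sample (X : Type*) (n : ℕ) : Type _ := Fin n → X × Bool

/-- `err_D(f) = Pr_{(x, y) ∼ D} [f x ≠ y]`. -/
def err {X : Type*} [MeasurableSpace X] (D : Measure (X × Bool)) (f : X → Bool) : ℝ :=
  D.real {p | f p.1 ≠ p.2}

/-- `err_S(f)`: the fraction of the examples of the sample `S` that `f` mislabels. -/
def empErr {X : Type*} {n : ℕ} (S : Sample X n) (f : X → Bool) : ℝ :=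
  ((Finset.univ.filter fun j => f (S j).1 ≠ (S j).2).card : ℝ) / n

/-- `F` shatters the finite set `s`: every labelling of `s` is realized by a member of `F`. -/
def Shatters {X : Type*} (F : Set (X → Bool)) (s : Finset X) : Prop :=
  ∀ g : X → Bool, ∃ f ∈ F, ∀ x ∈ s, f x = g x

/-- The VC dimension: the supremum of the sizes of the finite sets that `F` shatters. -/
def vcDim {X : Type*} (F : Set (X → Bool)) : ℕ∞ :=
  ⨆ (s : Finset X) (_ : Shatters F s), (s.card : ℕ∞)

/-- A learning rule: it maps every finite sample to a classifier. -/
abbrev Oracle (X : Type*) : Type _ := (n : ℕ) → Sample X n → X → Bool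

/-- The oracle `𝒪_F`: on every sample it returns a member of `F` with least error on the sample. -/
structure IsERM {X : Type*} (F : Set (X → Bool)) (O : Oracle X) : Prop where
  mem : ∀ (n : ℕ) (S : Sample X n), O n S ∈ F
  minimizes : ∀ (n : ℕ) (S : Sample X n), ∀ f ∈ F, empErr S (O n S) ≤ empErr S f

/-- The learned label is a measurable function of the sample and the point together
(without this the law of the algorithm below makes no sense). -/
def IsMeasurableOracle {X : Type*} [MeasurableSpace X] (O : Oracle X) : Prop :=
  ∀ n : ℕ, Measurable fun p : Sample X n × X => O n p.1 p.2

/-- The realizable setting: some member of `F` has error zero on every player's distribution. -/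
def Realizable {X : Type*} [MeasurableSpace X] {k : ℕ} (F : Set (X → Bool))
    (D : Fin k → Measure (X × Bool)) : Prop :=
  ∃ f ∈ F, ∀ i, err (D i) f = 0

/-- The majority function of `f 0, …, f (t - 1)`: it assigns to `x` the label that more than half
of the classifiers assign to it (and `false` in case of a tie). -/
def maj {X : Type*} {t : ℕ} (f : Fin t → X → Bool) (x : X) : Bool :=
  decide (t < 2 * (Finset.univ.filter fun r => f r x = true).card)

/-! ### The multiplicative weights loop

`k` players, `m` examples drawn from the weighted mixture in every round, `n` test examples drawn
from every player in every round, `ε'` the parameter of the test. -/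

/-- All the examples drawn in one round: `S` from the mixture, and `T i` from player `i`. -/
abbrev RoundData (X : Type*) (k m n : ℕ) : Type _ := Sample X m × (Fin k → Sample X n)

/-- The set `G` of the players on whose test sample `f` has error at most `3ε'/4`. -/
def fastTest {X : Type*} {k n : ℕ} (ε' : ℝ) (f : X → Bool) (T : Fin k → Sample X n) :
    Set (Fin k) :=
  {i | empErr (T i) f ≤ 3 / 4 * ε'}

open Classical in
/-- The weights after `r` rounds, as a function of the examples drawn so far: initially `1`, and
in every round the weights of the players outside the set returned by the test are doubled. -/
def weights {X : Type*} {k m n : ℕ} (O : Oracle X) (ε' : ℝ) :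
    (r : ℕ) → (Fin r → RoundData X k m n) → Fin k → ℕ
  | 0, _, _ => 1
  | r + 1, h, i =>
    let S := (h (Fin.last r)).1
    let T := (h (Fin.last r)).2
    let w := weights O ε' r (fun j => h j.castSucc)
    if i ∈ fastTest ε' (O m S) T then w i else 2 * w i

/-- The mixture `(1 / Φ) ∑ i, w i • D i`, where `Φ = ∑ i, w i`. -/
def mixture {X : Type*} [MeasurableSpace X] {k : ℕ} (D : Fin k → Measure (X × Bool))
    (w : Fin k → ℕ) : Measure (X × Bool) :=
  ∑ i, ((w i : ℝ≥0∞) / ∑ j, (w j : ℝ≥0∞)) • D i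

/-- The law of the examples drawn in a round that starts with the weights `w`: independent draws,
`m` from the mixture and `n` from each player. (The test examples are independent of the
classifier that they test, as that classifier is a function of the first component.) -/
def roundLaw {X : Type*} [MeasurableSpace X] {k : ℕ} (m n : ℕ) (D : Fin k → Measure (X × Bool))
    (w : Fin k → ℕ) : Measure (RoundData X k m n) :=
  (Measure.pi fun _ : Fin m => mixture D w).prod
    (Measure.pi fun i : Fin k => Measure.pi fun _ : Fin n => D i)

/-- The joint law of all the examples drawn in the first `r` rounds: conditionally on the first
`r` rounds, round `r + 1` has the law `roundLaw` with the current weights. -/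
def transcriptLaw {X : Type*} [MeasurableSpace X] {k : ℕ} (m n : ℕ) (O : Oracle X) (ε' : ℝ)
    (D : Fin k → Measure (X × Bool)) : (r : ℕ) → Measure (Fin r → RoundData X k m n)
  | 0 => Measure.dirac fun j => j.elim0
  | r + 1 =>
    (transcriptLaw m n O ε' D r).bind fun h =>
      (roundLaw m n D (weights O ε' r h)).map fun ρ =>
        (Fin.snoc h ρ : Fin (r + 1) → RoundData X k m n)

/-- The majority of the classifiers learned in the `t` rounds. -/
def output {X : Type*} {k m n t : ℕ} (O : Oracle X) (h : Fin t → RoundData X k m n) :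
    X → Bool :=
  maj fun r => O m (h r).1

/-! ### The parameters of Algorithm R2 -/

/-- `m_{ε,δ} = ⌈(C / ε) (d ln (1 / ε) + ln (1 / δ))⌉`. -/
def vcSampleSize (C : ℝ) (d : ℕ) (ε δ : ℝ) : ℕ :=
  ⌈C / ε * (d * Real.log (1 / ε) + Real.log (1 / δ))⌉₊

/-- The number of rounds `t = 150 ⌈log₂ (k / δ)⌉`. -/
def rounds (k : ℕ) (δ : ℝ) : ℕ := 150 * ⌈Real.logb 2 (k / δ)⌉₊

/-- `|S^(r)| = m_{ε'/16, δ'}` with `ε' = ε / 6` and `δ' = δ / (4 t)`. -/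
def mixSize (C₁ : ℝ) (d k : ℕ) (ε δ : ℝ) : ℕ :=
  vcSampleSize C₁ d (ε / 6 / 16) (δ / (4 * rounds k δ))

/-- `|T_i| = ⌈C₂ / ε'⌉` with `ε' = ε / 6`. -/
def testSize (C₂ : ℝ) (ε : ℝ) : ℕ := ⌈C₂ / (ε / 6)⌉₊

/-- The law of all the examples drawn by Algorithm R2. -/
def lawR2 {X : Type*} [MeasurableSpace X] {k : ℕ} (C₁ C₂ : ℝ) (d : ℕ) (O : Oracle X)
    (D : Fin k → Measure (X × Bool)) (ε δ : ℝ) :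
    Measure (Fin (rounds k δ) → RoundData X k (mixSize C₁ d k ε δ) (testSize C₂ ε)) :=
  transcriptLaw (mixSize C₁ d k ε δ) (testSize C₂ ε) O (ε / 6) D (rounds k δ)

/-- The total number of examples drawn by Algorithm R2: in every round `|S^(r)|` from the
mixture and `|T_i|` from each of the `k` players. -/
def numSamplesR2 (C₁ C₂ : ℝ) (d k : ℕ) (ε δ : ℝ) : ℕ :=
  rounds k δ * (mixSize C₁ d k ε δ + k * testSize C₂ ε)

end CollabPAC

end

namespace CollabPAC

/-! ### Chernoff bounds for the number of hits of an i.i.d. sample -/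

section Chernoff

variable {Z : Type*} {n : ℕ}

/-! Write `e = ε / 6`, `t = 150 L` with `L = ⌈log₂ (k / δ)⌉`, and call a round bad for player `i` if
its classifier has error above `e` on `D i`. If at most `60 L` rounds are bad for `i`, Markov's
inequality on the remaining rounds bounds the error of the majority by `6 e = ε` (`err_maj_le`). A
bad round either makes the test reject `i`, which doubles the weight of `i`, or is missed by the
test.

Rejections are controlled by the total weight. Every mixture is realizable, so empirical risk
minimization has mixture error at most `e / 16` except with probability `1 / 64`
(`measure_err_lt_le`, by symmetrization and Sauer–Shelah); then the players with error above `e / 2`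
carry at most an eighth of the weight. Adding the errors of the test, the conditional expectation of
the total weight grows by a factor of at most `37 / 32` per round (`lintegral_sum_weights_le`). More
than `45 L` rejections of one player would force a total weight above `2 ^ (45 L)`, which Markov's
inequality makes unlikely.

Misses have conditional probability at most `1 / 64` whatever the past, so `2` to the number of
misses grows in expectation by a factor of at most `65 / 64` per round
(`lintegral_two_pow_missed_le`), and `15 L` misses are unlikely. The union bound over the players
gives failure probability at most `2 k / 4 ^ L ≤ δ` (`transcriptLaw_fail_le`). A constant failure
probability per round suffices, because failed rounds are averaged into the growth factor and not
excluded by a union bound. -/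

lemma exp_mul_card_filter {p : Z → Prop} [DecidablePred p] (s : ℝ) (S : Fin n → Z) :
    Real.exp (s * (Finset.univ.filter fun j => p (S j)).card) =
      ∏ j, if p (S j) then Real.exp s else 1 := by
  rw [Finset.prod_ite, Finset.prod_const, Finset.prod_const_one, mul_one, ← Real.exp_nat_mul,
    mul_comm]

variable [MeasurableSpace Z]

lemma measurable_card_filter {p : Z → Prop} [DecidablePred p] (hp : MeasurableSet {z | p z}) :
    Measurable fun S : Fin n → Z => ((Finset.univ.filter fun j => p (S j)).card : ℝ) := by
  have h : (fun S : Fin n → Z => ((Finset.univ.filter fun j => p (S j)).card : ℝ)) =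
      fun S => ∑ j, if p (S j) then (1 : ℝ) else 0 := by
    funext S
    simp
  rw [h]
  refine Finset.measurable_sum _ fun j _ => ?_
  exact Measurable.ite (measurable_pi_apply j hp) measurable_const measurable_const

lemma integral_ite_const (μ : Measure Z) [IsProbabilityMeasure μ] {p : Z → Prop}
    [DecidablePred p] (hp : MeasurableSet {z | p z}) (c : ℝ) :
    ∫ z, (if p z then c else 1) ∂μ = 1 + μ.real {z | p z} * (c - 1) := by
  have h : (fun z => if p z then c else 1) =
      fun z => 1 + Set.indicator {z | p z} (fun _ => c - 1) z := by
    funext z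
    by_cases hz : p z <;> simp [hz]
  rw [h, integral_add (integrable_const _) ((integrable_const _).indicator hp),
    integral_indicator_const _ hp]
  simp

lemma integral_exp_mul_card_filter_le (μ : Measure Z) [IsProbabilityMeasure μ] {p : Z → Prop}
    [DecidablePred p] (hp : MeasurableSet {z | p z}) (s : ℝ) :
    ∫ S : Fin n → Z, Real.exp (s * (Finset.univ.filter fun j => p (S j)).card)
        ∂(Measure.pi fun _ => μ) ≤ Real.exp (n * (μ.real {z | p z} * (Real.exp s - 1))) := by
  simp_rw [exp_mul_card_filter]
  rw [integral_fintype_prod_eq_pow (ι := Fin n) (fun z => if p z then Real.exp s else 1),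
    integral_ite_const μ hp, Fintype.card_fin, Real.exp_nat_mul]
  refine pow_le_pow_left₀ ?_ ?_ n
  · have h1 : μ.real {z | p z} ≤ 1 := measureReal_le_one
    have h2 : 0 ≤ μ.real {z | p z} := measureReal_nonneg
    nlinarith [Real.exp_pos s]
  · rw [add_comm]
    exact Real.add_one_le_exp _

/-- Markov's inequality for the exponential moment. Keeping `s` on both sides of the event covers
the two tails at once: `s > 0` gives the upper one and `s < 0` the lower one. -/
lemma chernoff (μ : Measure Z) [IsProbabilityMeasure μ] {p : Z → Prop}
    [DecidablePred p] (hp : MeasurableSet {z | p z}) (s b : ℝ) :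
    (Measure.pi fun _ : Fin n => μ).real
        {S | s * b ≤ s * (Finset.univ.filter fun j => p (S j)).card} ≤
      Real.exp (n * (μ.real {z | p z} * (Real.exp s - 1)) - s * b) := by
  have hint : Integrable (fun S : Fin n → Z =>
      Real.exp (s * (Finset.univ.filter fun j => p (S j)).card)) (Measure.pi fun _ => μ) := by
    refine Integrable.of_bound (C := Real.exp (|s| * n)) ?_ (.of_forall fun S => ?_)
    · exact (Real.measurable_exp.comp
        (measurable_const.mul (measurable_card_filter hp))).aestronglyMeasurable
    · rw [Real.norm_eq_abs, Real.abs_exp, Real.exp_le_exp]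
      have h1 : ((Finset.univ.filter fun j => p (S j)).card : ℝ) ≤ n := by
        exact_mod_cast (Finset.card_filter_le _ _).trans (by simp)
      exact (mul_le_mul_of_nonneg_right (le_abs_self s) (by positivity)).trans
        (mul_le_mul_of_nonneg_left h1 (abs_nonneg s))
  have hm := mul_meas_ge_le_integral_of_nonneg (.of_forall fun S => (Real.exp_pos _).le) hint
    (Real.exp (s * b))
  simp only [Real.exp_le_exp] at hm
  rw [Real.exp_sub, le_div_iff₀ (Real.exp_pos _), mul_comm]
  exact hm.trans (integral_exp_mul_card_filter_le μ hp s)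

lemma exp_one_fourth_le : Real.exp (1 / 4) ≤ 1.3 := by
  refine le_of_pow_le_pow_left₀ (n := 4) (by norm_num) (by norm_num) ?_
  rw [← Real.exp_nat_mul]
  have := Real.exp_one_lt_d9
  norm_num at this ⊢
  linarith

lemma exp_neg_one_fourth_le : Real.exp (-(1 / 4)) ≤ 0.78 := by
  rw [Real.exp_neg, inv_le_comm₀ (Real.exp_pos _) (by norm_num)]
  refine le_of_pow_le_pow_left₀ (n := 4) (by norm_num) (Real.exp_pos _).le ?_
  rw [← Real.exp_nat_mul]
  have := Real.exp_one_gt_d9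
  norm_num at this ⊢
  linarith

lemma exp_le_one_div_64 {x : ℝ} (hx : x ≤ -4.5) : Real.exp x ≤ 1 / 64 := by
  have h : Real.exp (9 / 2) ≥ 64 := by
    refine le_of_pow_le_pow_left₀ (n := 2) (by norm_num) (Real.exp_pos _).le ?_
    have h9 : Real.exp (9 / 2) ^ 2 = Real.exp 1 ^ 9 := by
      rw [← Real.exp_nat_mul, ← Real.exp_nat_mul]; norm_num
    rw [h9]
    have := Real.exp_one_gt_d9
    calc (64 : ℝ) ^ 2 ≤ 2.7 ^ 9 := by norm_num
      _ ≤ _ := by gcongr; linarith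
  calc Real.exp x ≤ Real.exp (-(9 / 2)) := by gcongr; norm_num at hx ⊢; linarith
    _ = (Real.exp (9 / 2))⁻¹ := Real.exp_neg _
    _ ≤ 1 / 64 := by rw [one_div]; gcongr

/-- A set of measure at most `e / 2` is rarely hit by more than `3 e / 4` of the sample. -/
lemma pi_real_lt_card_filter_le (μ : Measure Z) [IsProbabilityMeasure μ] {p : Z → Prop}
    [DecidablePred p] (hp : MeasurableSet {z | p z}) {e : ℝ} (hne : 148 ≤ n * e)
    (hpe : μ.real {z | p z} ≤ e / 2) :
    (Measure.pi fun _ : Fin n => μ).real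
        {S | 3 / 4 * e * n < (Finset.univ.filter fun j => p (S j)).card} ≤ 1 / 64 := by
  refine le_trans (measureReal_mono fun S hS => ?_)
    ((chernoff (n := n) μ hp (1 / 4) (3 / 4 * e * n)).trans ?_)
  · simp only [Set.mem_ofPred_eq] at hS ⊢
    linarith
  -- The exponent is at most `(0.15 - 0.1875) n e = -0.0375 n e`, below `-4.5` because `n e ≥ 148`.
  · refine exp_le_one_div_64 ?_
    have h1 : μ.real {z | p z} * (Real.exp (1 / 4) - 1) ≤ e / 2 * 0.3 := by
      have := exp_one_fourth_le
      have := Real.add_one_le_exp (1 / 4 : ℝ)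
      exact mul_le_mul hpe (by norm_num at *; linarith) (by linarith)
        (measureReal_nonneg.trans hpe)
    have h2 := mul_le_mul_of_nonneg_left h1 n.cast_nonneg (α := ℝ)
    norm_num at h2 ⊢
    linarith

/-- A set of measure at least `e` is rarely hit by at most `3 e / 4` of the sample. -/
lemma pi_real_card_filter_le_le (μ : Measure Z) [IsProbabilityMeasure μ] {p : Z → Prop}
    [DecidablePred p] (hp : MeasurableSet {z | p z}) {e : ℝ} (hne : 148 ≤ n * e)
    (hpe : e ≤ μ.real {z | p z}) :
    (Measure.pi fun _ : Fin n => μ).real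
        {S | (Finset.univ.filter fun j => p (S j)).card ≤ 3 / 4 * e * n} ≤ 1 / 64 := by
  refine le_trans (measureReal_mono fun S hS => ?_)
    ((chernoff (n := n) μ hp (-(1 / 4)) (3 / 4 * e * n)).trans ?_)
  · simp only [Set.mem_ofPred_eq] at hS ⊢
    linarith
  -- The exponent is at most `(0.1875 - 0.22) n e = -0.0325 n e`, again below `-4.5`.
  · refine exp_le_one_div_64 ?_
    have h1 : e * (1 - Real.exp (-(1 / 4))) ≥ e * 0.22 := by
      have := exp_neg_one_fourth_le
      have he : 0 ≤ e := by
        by_contra hc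
        nlinarith [n.cast_nonneg (α := ℝ)]
      exact mul_le_mul_of_nonneg_left (by linarith) he
    have h3 : μ.real {z | p z} * (1 - Real.exp (-(1 / 4))) ≥ e * (1 - Real.exp (-(1 / 4))) := by
      have := exp_neg_one_fourth_le
      exact mul_le_mul_of_nonneg_right hpe (by linarith)
    have h2 := mul_le_mul_of_nonneg_left (h1.le.trans h3.le) n.cast_nonneg (α := ℝ)
    norm_num at h2 ⊢
    nlinarith

/-- A set of measure at least `a` is hit by at least `a / 2` of the sample with probability at
least one half, if `n` is large. -/
lemma pi_real_card_filter_lt_le_half (μ : Measure Z) [IsProbabilityMeasure μ] {p : Z → Prop}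
    [DecidablePred p] (hp : MeasurableSet {z | p z}) {a : ℝ} (hna : 148 ≤ n * a)
    (hpa : a ≤ μ.real {z | p z}) :
    (Measure.pi fun _ : Fin n => μ).real
        {S | (Finset.univ.filter fun j => p (S j)).card < a * n / 2} ≤ 1 / 2 := by
  refine le_trans (measureReal_mono fun S hS => ?_)
    ((pi_real_card_filter_le_le (n := n) μ hp hna hpa).trans (by norm_num))
  have : ((Finset.univ.filter fun j => p (S j)).card : ℝ) < a * n / 2 := hS
  simp only [Set.mem_ofPred_eq]
  nlinarith

end Chernoff

/-! ### The growth function -/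

section Growth

/-- The points `x i` may repeat, but not on a shattered index set: membership of `i` in a trace
depends only on `x i`, while shattering separates any two indices. Hence the image of the index set
is a set of the same size shattered by `F`. -/
lemma card_le_of_finset_shatters {X ι : Type*} [DecidableEq ι] {F : Set (X → Bool)} {d : ℕ}
    (hF : vcDim F = d) (x : ι → X) {𝒜 : Finset (Finset ι)}
    (h𝒜 : ∀ u ∈ 𝒜, ∃ f ∈ F, ∀ i, i ∈ u ↔ f (x i) = true) {s : Finset ι} (hs : 𝒜.Shatters s) :
    s.card ≤ d := by
  classical
  have hinj : Set.InjOn x s := by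
    intro i hi j hj hij
    by_contra hne
    obtain ⟨u, hu, hsu⟩ := hs (Finset.singleton_subset_iff.2 hi)
    obtain ⟨f, -, hf⟩ := h𝒜 u hu
    have hiu : i ∈ u := (Finset.mem_inter.1 (hsu ▸ Finset.mem_singleton_self i)).2
    have hju : j ∈ u := by rw [hf, ← hij, ← hf]; exact hiu
    have : j ∈ s ∩ u := Finset.mem_inter.2 ⟨hj, hju⟩
    rw [hsu, Finset.mem_singleton] at this
    exact hne this.symm
  have hsh : Shatters F (s.image x) := by
    intro g
    obtain ⟨u, hu, hsu⟩ := hs (Finset.filter_subset (fun i => g (x i) = true) s)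
    obtain ⟨f, hfF, hf⟩ := h𝒜 u hu
    refine ⟨f, hfF, fun y hy => ?_⟩
    obtain ⟨i, hi, rfl⟩ := Finset.mem_image.1 hy
    rw [Bool.eq_iff_iff, ← hf]
    have := Finset.ext_iff.1 hsu i
    simpa [hi] using this
  have hle : ((s.image x).card : ℕ∞) ≤ vcDim F :=
    le_iSup₂ (f := fun (s : Finset X) (_ : Shatters F s) => (s.card : ℕ∞)) _ hsh
  rw [hF, Finset.card_image_of_injOn hinj] at hle
  exact_mod_cast hle

/-- Sauer–Shelah for traces on a family of points indexed with repetitions. -/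
lemma card_patterns_le {X ι : Type*} [DecidableEq ι] [Fintype ι] {F : Set (X → Bool)} {d : ℕ}
    (hF : vcDim F = d) (x : ι → X) {𝒜 : Finset (Finset ι)}
    (h𝒜 : ∀ u ∈ 𝒜, ∃ f ∈ F, ∀ i, i ∈ u ↔ f (x i) = true) :
    𝒜.card ≤ ∑ i ∈ Finset.Iic d, (Fintype.card ι).choose i := by
  refine 𝒜.card_le_card_shatterer.trans (Finset.card_shatterer_le_sum_vcDim.trans ?_)
  refine Finset.sum_le_sum_of_subset (Finset.Iic_subset_Iic.2 ?_)
  exact Finset.sup_le fun s hs =>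
    card_le_of_finset_shatters hF x h𝒜 (Finset.mem_shatterer.1 hs)

lemma sum_choose_mul_pow_le {x : ℝ} (hx : 0 ≤ x) (hx1 : x ≤ 1) (n d : ℕ) :
    (∑ i ∈ Finset.Iic d, (n.choose i : ℝ)) * x ^ d ≤ (1 + x) ^ n := by
  have h1 : (1 + x) ^ n = ∑ i ∈ Finset.range (n + 1), (n.choose i : ℝ) * x ^ i := by
    rw [add_comm, add_pow]
    simp [mul_comm]
  have h2 : ∑ i ∈ Finset.range (n + 1), (n.choose i : ℝ) * x ^ i =
      ∑ i ∈ Finset.range (n + 1 + d), (n.choose i : ℝ) * x ^ i := by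
    -- Padding with zero terms makes the range contain all `i ≤ d` even when `d > n`.
    refine Finset.sum_subset (Finset.range_mono (by omega)) fun i _ hi => ?_
    rw [Nat.choose_eq_zero_of_lt (by simpa using hi)]
    simp
  rw [h1, h2, Finset.sum_mul]
  refine (Finset.sum_le_sum fun i hi => ?_).trans
    (Finset.sum_le_sum_of_subset_of_nonneg (f := fun i => (n.choose i : ℝ) * x ^ i) ?_
      fun i _ _ => by positivity)
  · exact mul_le_mul_of_nonneg_left
      (pow_le_pow_of_le_one hx hx1 (Finset.mem_Iic.1 hi)) (by positivity)
  · intro i hi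
    simp only [Finset.mem_Iic, Finset.mem_range] at hi ⊢
    omega

end Growth

/-! ### Symmetrization -/

section Symmetrization

/-- The component of a pair selected by a Boolean. -/
def pick {Z : Type*} (p : Z × Z) (b : Bool) : Z := if b then p.2 else p.1

/-- Swap the components of the pairs `W j` with `σ j = true`. -/
def swapBy {Z : Type*} {m : ℕ} (σ : Fin m → Bool) (W : Fin m → Z × Z) : Fin m → Z × Z :=
  fun j => (pick (W j) (σ j), pick (W j) (!σ j))

lemma measurePreserving_swapBy {Z : Type*} [MeasurableSpace Z] (μ : Measure Z)
    [IsProbabilityMeasure μ] {m : ℕ} (σ : Fin m → Bool) :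
    MeasurePreserving (swapBy σ) (Measure.pi fun _ : Fin m => μ.prod μ)
      (Measure.pi fun _ : Fin m => μ.prod μ) := by
  refine measurePreserving_pi (f := fun j p => (pick p (σ j), pick p (!σ j))) _ _ fun j => ?_
  cases σ j
  · exact MeasurePreserving.id _
  · exact Measure.measurePreserving_swap

/-- Few selections avoid all the errors of a table and leave many errors unselected. -/
lemma card_selections_mul_le {m c : ℕ} (E : Fin m → Bool → Prop) (B : Finset (Fin m → Bool))
    (hB : ∀ σ ∈ B, (∀ j, ¬ E j (σ j)) ∧
      ∃ J : Finset (Fin m), c ≤ J.card ∧ ∀ j ∈ J, E j (!σ j)) :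
    B.card * 2 ^ c ≤ 2 ^ m := by
  classical
  obtain rfl | ⟨τ, hτ⟩ := B.eq_empty_or_nonempty
  · simp
  obtain ⟨J, hJc, hJ⟩ := (hB τ hτ).2
  -- On `J` the entry opposite to `τ j` is an error, so every error-avoiding selection agrees with
  -- `τ` there; only the coordinates outside `J` are free.
  have hsub : B ⊆ Fintype.piFinset fun j => if j ∈ J then {τ j} else Finset.univ := by
    intro σ hσ
    rw [Fintype.mem_piFinset]
    intro j
    split_ifs with hj
    · have h1 := (hB σ hσ).1 j
      have h2 := hJ j hj
      rw [Finset.mem_singleton]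
      by_contra hne
      rw [Bool.eq_not_of_ne hne] at h1
      exact h1 h2
    · exact Finset.mem_univ _
  have hcard := Finset.card_le_card hsub
  rw [Fintype.card_piFinset] at hcard
  have hprod : (∏ j, (if j ∈ J then ({τ j} : Finset Bool) else Finset.univ).card) * 2 ^ J.card =
      2 ^ m := by
    have h2 : (2 : ℕ) ^ J.card = ∏ j, if j ∈ J then 2 else 1 := by
      rw [Finset.prod_ite_mem, Finset.univ_inter, Finset.prod_const]
    rw [h2, ← Finset.prod_mul_distrib]
    have h3 : ∀ j, (if j ∈ J then ({τ j} : Finset Bool) else Finset.univ).card *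
        (if j ∈ J then 2 else 1) = 2 := by
      intro j; split_ifs <;> simp
    rw [Finset.prod_congr rfl fun j _ => h3 j]
    simp
  calc B.card * 2 ^ c ≤ B.card * 2 ^ J.card := by gcongr; norm_num
    _ ≤ _ := Nat.mul_le_mul_right _ hcard
    _ = 2 ^ m := hprod

variable {X : Type*} {F : Set (X → Bool)} {O : Oracle X} {d m : ℕ}

/-- The first halves of the pairs are learned correctly, and on at least `c` of the second halves
the learned classifier errs. -/
def ghostEvent (O : Oracle X) (m c : ℕ) : Set ((Fin m → X × Bool) × (Fin m → X × Bool)) :=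
  {V | (∀ j, O m V.1 (V.1 j).1 = (V.1 j).2) ∧
    c ≤ (Finset.univ.filter fun j => O m V.1 (V.2 j).1 ≠ (V.2 j).2).card}

/-- `ghostEvent` on a sequence of pairs. -/
def ghostPairs (O : Oracle X) (m c : ℕ) : Set (Fin m → (X × Bool) × (X × Bool)) :=
  {W | (fun j => (W j).1, fun j => (W j).2) ∈ ghostEvent O m c}

-- The learned classifier depends on the swap `σ`, so the table of its errors does too. Grouping the
-- swaps by the trace of the classifier on all `2 m` points fixes the table inside each group, where
-- `card_selections_mul_le` applies; Sauer–Shelah bounds the number of groups.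
open Classical in
lemma card_swaps_mul_le (hF : vcDim F = d) (hO : IsERM F O) (c : ℕ)
    (W : Fin m → (X × Bool) × (X × Bool)) :
    (Finset.univ.filter fun σ => swapBy σ W ∈ ghostPairs O m c).card * 2 ^ c ≤
      (∑ i ∈ Finset.Iic d, (2 * m).choose i) * 2 ^ m := by
  let f : (Fin m → Bool) → X → Bool := fun σ => O m fun j => (swapBy σ W j).1
  let x : Fin m × Bool → X := fun q => (pick (W q.1) q.2).1
  let G : (Fin m → Bool) → Finset (Fin m × Bool) := fun σ =>
    Finset.univ.filter fun q => f σ (x q) = true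
  let 𝒜 : Finset (Finset (Fin m × Bool)) := Finset.univ.image G
  have h𝒜 : 𝒜.card ≤ ∑ i ∈ Finset.Iic d, (2 * m).choose i := by
    have := card_patterns_le (𝒜 := 𝒜) hF x fun u hu => by
      obtain ⟨σ, -, rfl⟩ := Finset.mem_image.1 hu
      exact ⟨f σ, hO.mem _ _, fun i => by simp [G]⟩
    simpa [mul_comm] using this
  have hfib : ∀ u ∈ 𝒜, (Finset.univ.filter fun σ => swapBy σ W ∈ ghostPairs O m c ∧
      G σ = u).card * 2 ^ c ≤ 2 ^ m := by
    intro u _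
    refine card_selections_mul_le
      (fun j b => decide ((j, b) ∈ u) ≠ (pick (W j) b).2) _ fun σ hσ => ?_
    obtain ⟨⟨h1, h2⟩, rfl⟩ := (Finset.mem_filter.1 hσ).2
    have hlab : ∀ j b, decide ((j, b) ∈ G σ) = f σ (pick (W j) b).1 := by
      intro j b
      simp [G, x]
    refine ⟨fun j => ?_, _, h2, fun j hj => ?_⟩
    · rw [hlab, not_not]
      exact h1 j
    · rw [hlab]
      exact (Finset.mem_filter.1 hj).2
  have hsum : (Finset.univ.filter fun σ => swapBy σ W ∈ ghostPairs O m c).card =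
      ∑ u ∈ 𝒜, (Finset.univ.filter fun σ => swapBy σ W ∈ ghostPairs O m c ∧ G σ = u).card := by
    rw [Finset.card_eq_sum_card_fiberwise (f := G) (t := 𝒜)
      fun σ _ => Finset.mem_coe.2 (Finset.mem_image_of_mem G (Finset.mem_univ σ))]
    simp only [Finset.filter_filter]
  rw [hsum, Finset.sum_mul]
  calc _ ≤ ∑ u ∈ 𝒜, 2 ^ m := Finset.sum_le_sum hfib
    _ = 𝒜.card * 2 ^ m := by simp
    _ ≤ _ := Nat.mul_le_mul_right _ h𝒜

variable [MeasurableSpace X]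

/-- The set of indices satisfying `p` is a measurable function into a finite discrete space. -/
lemma measurableSet_forall_finset {α : Type*} [MeasurableSpace α] {p : α → Fin m → Prop}
    [∀ a, DecidablePred (p a)] (hp : ∀ j, MeasurableSet {a | p a j}) (s : Set (Finset (Fin m))) :
    MeasurableSet {a | Finset.univ.filter (p a) ∈ s} := by
  have hm : Measurable fun a => fun j => decide (p a j) := by
    refine measurable_pi_lambda _ fun j => ?_
    refine measurable_to_bool ?_
    convert hp j using 1
    ext a
    simp
  convert hm (MeasurableSet.of_discrete
    (s := {v : Fin m → Bool | (Finset.univ.filter fun j => v j = true) ∈ s})) using 1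
  ext a
  simp

lemma IsMeasurableOracle.measurableSet_ne (hO : IsMeasurableOracle O) {α : Type*}
    [MeasurableSpace α] {S : α → Sample X m} {z : α → X × Bool} (hS : Measurable S)
    (hz : Measurable z) : MeasurableSet {a | O m (S a) (z a).1 ≠ (z a).2} := by
  have h1 : Measurable fun a => O m (S a) (z a).1 :=
    (hO m).comp (hS.prodMk (measurable_fst.comp hz))
  exact (measurableSet_eq_fun h1 (measurable_snd.comp hz)).compl

lemma measurableSet_ghostEvent (hO : IsMeasurableOracle O) (c : ℕ) :
    MeasurableSet (ghostEvent O m c) := by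
  have h1 : MeasurableSet {V : (Fin m → X × Bool) × (Fin m → X × Bool) |
      ∀ j, O m V.1 (V.1 j).1 = (V.1 j).2} := by
    have : {V : (Fin m → X × Bool) × (Fin m → X × Bool) |
      ∀ j, O m V.1 (V.1 j).1 = (V.1 j).2} =
        ⋂ j, {V | O m V.1 (V.1 j).1 ≠ (V.1 j).2}ᶜ := by
      ext V; simp
    rw [this]
    exact MeasurableSet.iInter fun j => (hO.measurableSet_ne measurable_fst
      ((measurable_pi_apply j).comp measurable_fst)).compl
  refine h1.inter (measurableSet_forall_finset
    (p := fun (V : (Fin m → X × Bool) × (Fin m → X × Bool)) j => O m V.1 (V.2 j).1 ≠ (V.2 j).2)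
    (fun j => ?_) {u | c ≤ u.card})
  exact hO.measurableSet_ne measurable_fst ((measurable_pi_apply j).comp measurable_snd)

lemma measurePreserving_unzip {Z : Type*} [MeasurableSpace Z] (μ : Measure Z)
    [IsProbabilityMeasure μ] (m : ℕ) :
    MeasurePreserving (fun W : Fin m → Z × Z => (fun j => (W j).1, fun j => (W j).2))
      (Measure.pi fun _ => μ.prod μ) ((Measure.pi fun _ => μ).prod (Measure.pi fun _ => μ)) :=
  measurePreserving_arrowProdEquivProdArrow Z Z (Fin m) (fun _ => μ) (fun _ => μ)

/-- Swapping inside i.i.d. pairs preserves their law, so the probability equals its average over all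
`2 ^ m` swaps; `card_swaps_mul_le` bounds that average for each fixed sequence of pairs. -/
lemma measure_ghostEvent_mul_le (hF : vcDim F = d) (hO : IsERM F O)
    (hOm : IsMeasurableOracle O) (μ : Measure (X × Bool)) [IsProbabilityMeasure μ] (c : ℕ) :
    ((Measure.pi fun _ : Fin m => μ).prod (Measure.pi fun _ : Fin m => μ)) (ghostEvent O m c)
      * 2 ^ c ≤ ∑ i ∈ Finset.Iic d, ((2 * m).choose i : ℝ≥0∞) := by
  classical
  have hQ : MeasurableSet (ghostPairs O m c) :=
    (measurePreserving_unzip μ m).measurable (measurableSet_ghostEvent hOm c)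
  set P := Measure.pi fun _ : Fin m => μ.prod μ with hP
  rw [← (measurePreserving_unzip μ m).measure_preimage
    (measurableSet_ghostEvent hOm c).nullMeasurableSet]
  change P (ghostPairs O m c) * 2 ^ c ≤ _
  set N : ℝ≥0∞ := ∑ i ∈ Finset.Iic d, ((2 * m).choose i : ℝ≥0∞) with hN
  have h2 : (2 : ℝ≥0∞) ^ m ≠ 0 := by simp
  have h2' : (2 : ℝ≥0∞) ^ m ≠ ∞ := by simp
  have key : P (ghostPairs O m c) * 2 ^ m * 2 ^ c ≤ N * 2 ^ m := by
    have h1 : P (ghostPairs O m c) * 2 ^ m =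
        ∑ σ : Fin m → Bool, P (swapBy σ ⁻¹' ghostPairs O m c) := by
      rw [Finset.sum_congr rfl fun σ _ =>
        (measurePreserving_swapBy μ σ).measure_preimage hQ.nullMeasurableSet]
      simp [mul_comm, hP]
    have h3 : ∀ σ : Fin m → Bool, P (swapBy σ ⁻¹' ghostPairs O m c) =
        ∫⁻ W, (swapBy σ ⁻¹' ghostPairs O m c).indicator 1 W ∂P := fun σ =>
      (lintegral_indicator_one ((measurePreserving_swapBy μ σ).measurable hQ)).symm
    rw [h1, Finset.sum_congr rfl fun σ _ => h3 σ, ← lintegral_finsetSum _ fun σ _ =>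
      measurable_one.indicator ((measurePreserving_swapBy μ σ).measurable hQ),
      ← lintegral_mul_const' _ _ (by simp)]
    calc _ ≤ ∫⁻ _, N * 2 ^ m ∂P := lintegral_mono fun W => ?_
      _ = N * 2 ^ m := by simp
    have h4 : ∑ σ : Fin m → Bool, (swapBy σ ⁻¹' ghostPairs O m c).indicator
        (1 : (Fin m → (X × Bool) × (X × Bool)) → ℝ≥0∞) W = (Finset.univ.filter fun σ => swapBy σ W ∈ ghostPairs O m c).card := by
      simp [Set.indicator_apply]
    simp only [h4, hN]
    exact_mod_cast card_swaps_mul_le hF hO c W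
  rw [mul_right_comm] at key
  exact (ENNReal.mul_le_mul_iff_left h2 h2').1 key

end Symmetrization

/-! ### The sample complexity of empirical risk minimization in the realizable case -/

section PAC

variable {X : Type*} [MeasurableSpace X] {F : Set (X → Bool)} {O : Oracle X} {d m : ℕ}

lemma IsMeasurableOracle.measurable_apply (hO : IsMeasurableOracle O) (S : Sample X m) :
    Measurable (O m S) :=
  (hO m).comp measurable_prodMk_left

lemma measurableSet_errors {f : X → Bool} (hf : Measurable f) :
    MeasurableSet {p : X × Bool | f p.1 ≠ p.2} :=
  (measurableSet_eq_fun (hf.comp measurable_fst) measurable_snd).compl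

lemma err_nonneg (D : Measure (X × Bool)) (f : X → Bool) : 0 ≤ err D f :=
  measureReal_nonneg

lemma IsMeasurableOracle.measurable_err (hO : IsMeasurableOracle O) (μ : Measure (X × Bool))
    [IsProbabilityMeasure μ] : Measurable fun S : Sample X m => err μ (O m S) := by
  have h : MeasurableSet {q : Sample X m × (X × Bool) | O m q.1 q.2.1 ≠ q.2.2} :=
    hO.measurableSet_ne measurable_fst measurable_snd
  exact (measurable_measure_prodMk_left (ν := μ) h).ennreal_toReal

lemma IsERM.ae_consistent (hO : IsERM F O) (μ : Measure (X × Bool)) [IsProbabilityMeasure μ]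
    {g : X → Bool} (hg : g ∈ F) (hμ : err μ g = 0) :
    ∀ᵐ S ∂(Measure.pi fun _ : Fin m => μ), ∀ j, O m S (S j).1 = (S j).2 := by
  have h0 : ∀ᵐ p ∂μ, g p.1 = p.2 := by
    rw [ae_iff]
    exact (measureReal_eq_zero_iff).1 hμ
  have h1 : ∀ᵐ S ∂(Measure.pi fun _ : Fin m => μ), ∀ j, g (S j).1 = (S j).2 :=
    ae_all_iff.2 fun j =>
      (measurePreserving_eval (fun _ : Fin m => μ) j).quasiMeasurePreserving.ae h0
  filter_upwards [h1] with S hS j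
  have hle := hO.minimizes m S g hg
  have hz : empErr S g = 0 := by simp [empErr, hS]
  have hm : (m : ℝ) ≠ 0 := by
    have := j.pos
    positivity
  rw [hz, empErr, div_le_iff₀ (lt_of_le_of_ne m.cast_nonneg hm.symm), zero_mul] at hle
  have hcard : (Finset.univ.filter fun j => O m S (S j).1 ≠ (S j).2).card = 0 := by
    exact_mod_cast le_antisymm hle (by positivity)
  have := Finset.filter_eq_empty_iff.1 (Finset.card_eq_zero.1 hcard) (Finset.mem_univ j)
  simpa using this

/-- Given a first sample whose classifier has error above `a`, an independent second sample reveals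
at least `a m / 2` mistakes with probability at least one half. Consistency on the first sample is
almost sure by realizability. -/
lemma measure_err_lt_le_ghostEvent (hO : IsERM F O) (hOm : IsMeasurableOracle O)
    (μ : Measure (X × Bool)) [IsProbabilityMeasure μ] {g : X → Bool} (hg : g ∈ F)
    (hμ : err μ g = 0) {a : ℝ} (hma : 148 ≤ m * a) :
    (Measure.pi fun _ : Fin m => μ) {S | a < err μ (O m S)} ≤
      2 * ((Measure.pi fun _ : Fin m => μ).prod (Measure.pi fun _ : Fin m => μ))
        (ghostEvent O m ⌈a * m / 2⌉₊) := by
  set P := Measure.pi fun _ : Fin m => μ with hP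
  have hE : MeasurableSet {S : Sample X m | a < err μ (O m S)} :=
    measurableSet_lt measurable_const (hOm.measurable_err μ)
  rw [Measure.prod_apply (measurableSet_ghostEvent hOm _),
    ← lintegral_const_mul _ (measurable_measure_prodMk_left (measurableSet_ghostEvent hOm _)),
    ← lintegral_indicator_one hE]
  refine lintegral_mono_ae ?_
  filter_upwards [hO.ae_consistent (m := m) μ hg hμ] with S hS
  by_cases hSE : a < err μ (O m S)
  · simp only [Set.indicator_apply, Set.mem_ofPred_eq, hSE, if_true, Pi.one_apply]
    have hf := measurableSet_errors (hOm.measurable_apply S)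
    have hlow := pi_real_card_filter_lt_le_half (n := m) μ
      (p := fun z : X × Bool => O m S z.1 ≠ z.2) hf hma hSE.le
    set B := {T : Sample X m |
      ((Finset.univ.filter fun j => O m S (T j).1 ≠ (T j).2).card : ℝ) < a * m / 2} with hB
    have hBm : MeasurableSet B := measurableSet_lt
      (measurable_card_filter (p := fun z : X × Bool => O m S z.1 ≠ z.2) hf) measurable_const
    have hsub : Bᶜ ⊆ Prod.mk S ⁻¹' ghostEvent O m ⌈a * m / 2⌉₊ := by
      intro T hT
      refine ⟨hS, Nat.ceil_le.2 ?_⟩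
      simpa [hB] using hT
    have hc : (1 / 2 : ℝ) ≤ P.real Bᶜ := by
      rw [probReal_compl_eq_one_sub hBm]
      change P.real B ≤ 1 / 2 at hlow
      linarith
    have hc' : ENNReal.ofReal (1 / 2) ≤ P Bᶜ := ENNReal.ofReal_le_of_le_toReal hc
    calc (1 : ℝ≥0∞) = 2 * ENNReal.ofReal (1 / 2) := by
          rw [← ENNReal.ofReal_ofNat 2, ← ENNReal.ofReal_mul (by norm_num)]; norm_num
      _ ≤ 2 * P Bᶜ := by gcongr
      _ ≤ _ := by gcongr
  · simp [hSE]

lemma three_le_log {δ : ℝ} (hδ : 0 < δ) (hδ' : δ ≤ 1 / 64) : 3 ≤ Real.log (1 / δ) := by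
  rw [Real.le_log_iff_exp_le (by positivity)]
  calc Real.exp 3 = Real.exp 1 ^ 3 := by rw [← Real.exp_nat_mul]; norm_num
    _ ≤ 2.72 ^ 3 := by gcongr; linarith [Real.exp_one_lt_d9]
    _ ≤ 64 := by norm_num
    _ ≤ 1 / δ := by rw [le_div_iff₀ hδ]; linarith

/-- The growth function costs `exp (0.2 a m + 2 d ln (1 / a))`, by `sum_choose_mul_pow_le` at `x = a
/ 10 ≥ a ^ 2`, while `2 ^ (a m / 2) ≥ exp (0.34 a m)`. The surplus `0.14 a m` is at least `7 (d ln
(1 / a) + ln (1 / δ))`, which pays for `2 d ln (1 / a)`, for `1 / δ` and for the factor `2 ≤ 1 / δ`.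
-/
lemma sum_choose_mul_two_pow_le {a δ : ℝ} (ha : 0 < a) (ha' : a ≤ 1 / 10)
    (hδ : 0 < δ) (hδ' : δ ≤ 1 / 64)
    (hm : 50 * (d * Real.log (1 / a) + Real.log (1 / δ)) ≤ m * a) :
    2 * (∑ i ∈ Finset.Iic d, ((2 * m).choose i : ℝ)) ≤ δ * 2 ^ ⌈a * m / 2⌉₊ := by
  set N := ∑ i ∈ Finset.Iic d, ((2 * m).choose i : ℝ) with hN
  have hl3 := three_le_log hδ hδ'
  have hla : 0 ≤ Real.log (1 / a) := Real.log_nonneg (by rw [le_div_iff₀ ha]; linarith)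
  have h1 : N ≤ Real.exp (2 * m * (a / 10)) * Real.exp (d * (2 * Real.log (1 / a))) := by
    have h := sum_choose_mul_pow_le (x := a / 10) (by positivity) (by linarith) (2 * m) d
    have hup : (1 + a / 10) ^ (2 * m) ≤ Real.exp (2 * m * (a / 10)) := by
      have := pow_le_pow_left₀ (by positivity) (Real.add_one_le_exp (a / 10)) (2 * m)
      rw [← Real.exp_nat_mul] at this
      rw [add_comm]
      exact_mod_cast this
    have hlow : (a ^ 2) ^ d ≤ (a / 10) ^ d := by
      refine pow_le_pow_left₀ (by positivity) ?_ d
      nlinarith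
    have hN0 : 0 ≤ N := by positivity
    have hea : Real.exp (d * (2 * Real.log (1 / a))) = ((a ^ 2) ^ d)⁻¹ := by
      rw [Real.exp_nat_mul, ← inv_pow, show 2 * Real.log (1 / a) = Real.log ((1 / a) ^ 2) by
        rw [Real.log_pow]; norm_num, Real.exp_log (by positivity)]
      simp
    rw [hea, ← div_eq_mul_inv, le_div_iff₀ (by positivity)]
    exact (mul_le_mul_of_nonneg_left hlow hN0).trans (h.trans hup)
  have h2 : Real.exp (0.34 * (a * m)) ≤ 2 ^ ⌈a * m / 2⌉₊ := by
    have : (2 : ℝ) ^ ⌈a * m / 2⌉₊ = Real.exp (⌈a * m / 2⌉₊ * Real.log 2) := by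
      rw [Real.exp_nat_mul, Real.exp_log (by norm_num)]
    rw [this, Real.exp_le_exp]
    have hc := Nat.le_ceil (a * m / 2)
    have := Real.log_two_gt_d9
    have ham : 0 ≤ a * m := by positivity
    nlinarith
  have h3 : (2 : ℝ) ≤ Real.exp (Real.log (1 / δ)) := by
    have := Real.add_one_le_exp (Real.log (1 / δ))
    linarith
  have hd : 0 ≤ d * Real.log (1 / a) := by positivity
  calc 2 * N ≤ Real.exp (Real.log (1 / δ)) *
        (Real.exp (2 * m * (a / 10)) * Real.exp (d * (2 * Real.log (1 / a)))) := by gcongr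
    _ = Real.exp (Real.log (1 / δ) + (2 * m * (a / 10) + d * (2 * Real.log (1 / a)))) := by
        rw [Real.exp_add, Real.exp_add]
    _ ≤ Real.exp (Real.log δ + 0.34 * (a * m)) := by
        rw [Real.exp_le_exp, one_div δ, Real.log_inv]
        rw [one_div δ, Real.log_inv] at hm hl3
        linarith
    _ ≤ _ := by
        rw [Real.exp_add, Real.exp_log hδ]
        gcongr

/-- **Realizable PAC learning**: a consistent learner whose range has VC dimension `d` has error at
most `a` with probability `1 - δ` after `(50 / a) (d ln (1 / a) + ln (1 / δ))` examples. -/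
theorem measure_err_lt_le (hF : vcDim F = d) (hO : IsERM F O) (hOm : IsMeasurableOracle O)
    (μ : Measure (X × Bool)) [IsProbabilityMeasure μ] {g : X → Bool} (hg : g ∈ F)
    (hμ : err μ g = 0) {a δ : ℝ} (ha : 0 < a) (ha' : a ≤ 1 / 10) (hδ : 0 < δ)
    (hδ' : δ ≤ 1 / 64) (hm : 50 * (d * Real.log (1 / a) + Real.log (1 / δ)) ≤ m * a) :
    (Measure.pi fun _ : Fin m => μ) {S | a < err μ (O m S)} ≤ ENNReal.ofReal δ := by
  have hla : 0 ≤ Real.log (1 / a) := Real.log_nonneg (by rw [le_div_iff₀ ha]; linarith)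
  have hma : 148 ≤ m * a := by
    have := three_le_log hδ hδ'
    have hd : 0 ≤ d * Real.log (1 / a) := by positivity
    linarith
  have h1 := measure_err_lt_le_ghostEvent hO hOm μ hg hμ hma
  have h2 := measure_ghostEvent_mul_le (m := m) hF hO hOm μ ⌈a * m / 2⌉₊
  have h3 : 2 * (∑ i ∈ Finset.Iic d, ((2 * m).choose i : ℝ≥0∞)) ≤
      ENNReal.ofReal δ * 2 ^ ⌈a * m / 2⌉₊ := by
    have := ENNReal.ofReal_le_ofReal (sum_choose_mul_two_pow_le ha ha' hδ hδ' hm)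
    rw [ENNReal.ofReal_mul (by norm_num), ENNReal.ofReal_mul hδ.le,
      ENNReal.ofReal_sum_of_nonneg (by intros; positivity),
      ENNReal.ofReal_pow (by norm_num)] at this
    simpa using this
  refine (ENNReal.mul_le_mul_iff_left (c := 2 ^ ⌈a * m / 2⌉₊) (by simp) (by simp)).1 ?_
  calc _ ≤ _ := mul_le_mul_left h1 _
    _ ≤ _ := by
      rw [mul_assoc]
      exact mul_le_mul_right h2 _
    _ ≤ _ := h3

end PAC

/-! ### The mixture -/

section Mixture

variable {X : Type*} [MeasurableSpace X] {k : ℕ} (D : Fin k → Measure (X × Bool))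
  (w : Fin k → ℕ)

lemma mixture_apply (A : Set (X × Bool)) :
    mixture D w A = ∑ i, (w i : ℝ≥0∞) / (∑ j, (w j : ℝ≥0∞)) * D i A := by
  simp [mixture]

variable [∀ i, IsProbabilityMeasure (D i)]

lemma mixture_univ : mixture D w Set.univ = (∑ j, (w j : ℝ≥0∞)) / ∑ j, (w j : ℝ≥0∞) := by
  simp [mixture_apply, ENNReal.div_eq_inv_mul, ← Finset.mul_sum]

/-- This includes weights of sum zero, where the total mass is `0 / 0 = 0`; `measurable_map_snoc`
needs finiteness for every weight vector. -/
instance : IsFiniteMeasure (mixture D w) :=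
  ⟨by rw [mixture_univ]; exact ENNReal.div_self_le_one.trans_lt ENNReal.one_lt_top⟩

lemma isProbabilityMeasure_mixture (hw : ∑ j, w j ≠ 0) : IsProbabilityMeasure (mixture D w) := by
  refine ⟨?_⟩
  rw [mixture_univ]
  refine ENNReal.div_self ?_ ?_
  · exact_mod_cast hw
  · exact ENNReal.sum_ne_top.2 fun i _ => ENNReal.natCast_ne_top _

lemma sum_mul_err_mixture (hw : ∑ j, w j ≠ 0) (f : X → Bool) :
    (∑ j, (w j : ℝ)) * err (mixture D w) f = ∑ i, w i * err (D i) f := by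
  have hW : (∑ j, (w j : ℝ)) ≠ 0 := by exact_mod_cast hw
  have : err (mixture D w) f = ∑ i, (w i : ℝ) / (∑ j, (w j : ℝ)) * err (D i) f := by
    have hW' : (∑ j, (w j : ℝ≥0∞)) ≠ 0 := by exact_mod_cast hw
    rw [err, measureReal_def, mixture_apply, ENNReal.toReal_sum fun i _ =>
      ENNReal.mul_ne_top (ENNReal.div_ne_top (ENNReal.natCast_ne_top _) hW') (measure_ne_top _ _)]
    refine Finset.sum_congr rfl fun i _ => ?_
    rw [ENNReal.toReal_mul, ENNReal.toReal_div, ENNReal.toReal_natCast,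
      ENNReal.toReal_sum fun i _ => ENNReal.natCast_ne_top _]
    simp [err, measureReal_def]
  rw [this, Finset.mul_sum]
  refine Finset.sum_congr rfl fun i _ => ?_
  field_simp

lemma err_mixture_eq_zero {f : X → Bool} (hf : ∀ i, err (D i) f = 0) (hw : ∑ j, w j ≠ 0) :
    err (mixture D w) f = 0 := by
  have h := sum_mul_err_mixture D w hw f
  simp only [hf, mul_zero, Finset.sum_const_zero, mul_eq_zero] at h
  exact h.resolve_left (by exact_mod_cast hw)

/-- If the mixture error is at most `e / 16`, the players with error above `e / 2` carry at most
one eighth of the weight. -/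
lemma sum_weight_ite_le (hw : ∑ j, w j ≠ 0) {f : X → Bool} {e : ℝ} (he : 0 < e)
    (hf : err (mixture D w) f ≤ e / 16) :
    ∑ i, (w i : ℝ) * (if e / 2 < err (D i) f then 1 else 0) ≤ 1 / 8 * ∑ i, (w i : ℝ) := by
  have h := sum_mul_err_mixture D w hw f
  have h1 : ∑ i, (w i : ℝ) * (if e / 2 < err (D i) f then 1 else 0) * (e / 2) ≤
      ∑ i, w i * err (D i) f := by
    refine Finset.sum_le_sum fun i _ => ?_
    rw [mul_assoc]
    refine mul_le_mul_of_nonneg_left ?_ (by positivity)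
    split_ifs with hi
    · linarith
    · simpa using err_nonneg _ _
  rw [← Finset.sum_mul, ← h] at h1
  have h2 : (∑ j, (w j : ℝ)) * err (mixture D w) f ≤ (∑ j, (w j : ℝ)) * (e / 16) :=
    mul_le_mul_of_nonneg_left hf (by positivity)
  nlinarith

end Mixture

/-! ### One round -/

section Round

variable {X : Type*} [MeasurableSpace X] {F : Set (X → Bool)} {O : Oracle X} {d k m n : ℕ}

lemma measurableSet_fastTest (hO : IsMeasurableOracle O) (e : ℝ) (i : Fin k) :
    MeasurableSet {ρ : RoundData X k m n | i ∈ fastTest e (O m ρ.1) ρ.2} := by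
  refine measurableSet_forall_finset
    (p := fun (ρ : RoundData X k m n) j => O m ρ.1 (ρ.2 i j).1 ≠ (ρ.2 i j).2)
    (fun j => ?_) {u | (u.card : ℝ) / n ≤ 3 / 4 * e}
  exact hO.measurableSet_ne measurable_fst
    ((measurable_pi_apply j).comp ((measurable_pi_apply i).comp measurable_snd))

variable (D : Fin k → Measure (X × Bool)) [∀ i, IsProbabilityMeasure (D i)]

lemma le_one_div_64_of_real_le {α : Type*} [MeasurableSpace α] {μ : Measure α} [IsFiniteMeasure μ]
    {A : Set α} (h : μ.real A ≤ 1 / 64) : μ A ≤ 1 / 64 := by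
  refine (ENNReal.toReal_le_toReal (measure_ne_top _ _) (by simp)).1 ?_
  simpa [measureReal_def] using h

/-- `FastTest` accepts players with small error. -/
lemma measure_notMem_fastTest_le {e : ℝ} (hn : 0 < n) (hne : 148 ≤ n * e) {f : X → Bool}
    (hf : Measurable f) (i : Fin k) (hi : err (D i) f ≤ e / 2) :
    (Measure.pi fun i : Fin k => Measure.pi fun _ : Fin n => D i) {T | i ∉ fastTest e f T} ≤
      1 / 64 := by
  have hE := measurableSet_errors hf
  have hA : MeasurableSet {T : Sample X n | 3 / 4 * e * n <
      ((Finset.univ.filter fun j => f (T j).1 ≠ (T j).2).card : ℝ)} :=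
    measurableSet_lt measurable_const
      (measurable_card_filter (p := fun z : X × Bool => f z.1 ≠ z.2) hE)
  have h2 : {T : Fin k → Sample X n | i ∉ fastTest e f T} = Function.eval i ⁻¹'
      {T : Sample X n | 3 / 4 * e * n <
        ((Finset.univ.filter fun j => f (T j).1 ≠ (T j).2).card : ℝ)} := by
    ext T
    simp [fastTest, empErr, lt_div_iff₀ (Nat.cast_pos.2 hn : (0 : ℝ) < n)]
  rw [h2, (measurePreserving_eval (fun i : Fin k => Measure.pi fun _ : Fin n => D i)
    i).measure_preimage hA.nullMeasurableSet]
  exact le_one_div_64_of_real_le (pi_real_lt_card_filter_le (n := n) (D i)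
    (p := fun z : X × Bool => f z.1 ≠ z.2) hE hne hi)

/-- `FastTest` rejects players with large error. -/
lemma measure_mem_fastTest_le {e : ℝ} (hn : 0 < n) (hne : 148 ≤ n * e) {f : X → Bool}
    (hf : Measurable f) (i : Fin k) (hi : e ≤ err (D i) f) :
    (Measure.pi fun i : Fin k => Measure.pi fun _ : Fin n => D i) {T | i ∈ fastTest e f T} ≤
      1 / 64 := by
  have hE := measurableSet_errors hf
  have hA : MeasurableSet {T : Sample X n |
      ((Finset.univ.filter fun j => f (T j).1 ≠ (T j).2).card : ℝ) ≤ 3 / 4 * e * n} :=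
    measurableSet_le (measurable_card_filter (p := fun z : X × Bool => f z.1 ≠ z.2) hE)
      measurable_const
  have h2 : {T : Fin k → Sample X n | i ∈ fastTest e f T} = Function.eval i ⁻¹'
      {T : Sample X n | ((Finset.univ.filter fun j => f (T j).1 ≠ (T j).2).card : ℝ) ≤
        3 / 4 * e * n} := by
    ext T
    simp [fastTest, empErr, div_le_iff₀ (Nat.cast_pos.2 hn : (0 : ℝ) < n)]
  rw [h2, (measurePreserving_eval (fun i : Fin k => Measure.pi fun _ : Fin n => D i)
    i).measure_preimage hA.nullMeasurableSet]
  exact le_one_div_64_of_real_le (pi_real_card_filter_le_le (n := n) (D i)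
    (p := fun z : X × Bool => f z.1 ≠ z.2) hE hne hi)

instance (w : Fin k → ℕ) : IsFiniteMeasure (roundLaw m n D w) := by
  unfold roundLaw; infer_instance

lemma isProbabilityMeasure_roundLaw {w : Fin k → ℕ} (hw : ∑ j, w j ≠ 0) :
    IsProbabilityMeasure (roundLaw m n D w) := by
  have := isProbabilityMeasure_mixture D w hw
  unfold roundLaw
  infer_instance

/-- The test rejects player `i` with probability at most `1 / 64`, plus the probability that the
learned classifier has large error on `D i`. -/
lemma roundLaw_notMem_fastTest_le (hO : IsMeasurableOracle O) {w : Fin k → ℕ}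
    (hw : ∑ j, w j ≠ 0) {e : ℝ} (hn : 0 < n) (hne : 148 ≤ n * e) (i : Fin k) :
    roundLaw m n D w {ρ | i ∉ fastTest e (O m ρ.1) ρ.2} ≤
      1 / 64 + (Measure.pi fun _ : Fin m => mixture D w) {S | e / 2 < err (D i) (O m S)} := by
  have := isProbabilityMeasure_mixture D w hw
  have hE : MeasurableSet {S : Sample X m | e / 2 < err (D i) (O m S)} :=
    measurableSet_lt measurable_const (hO.measurable_err (D i))
  have hB : MeasurableSet {ρ : RoundData X k m n | i ∉ fastTest e (O m ρ.1) ρ.2} :=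
    (measurableSet_fastTest hO e i).compl
  rw [roundLaw, Measure.prod_apply hB,
    ← lintegral_indicator_one hE]
  calc _ ≤ ∫⁻ S, (1 / 64 + {S : Sample X m | e / 2 < err (D i) (O m S)}.indicator 1 S)
        ∂(Measure.pi fun _ : Fin m => mixture D w) := lintegral_mono fun S => ?_
    _ = _ := by
      rw [lintegral_add_left measurable_const]
      simp
  by_cases hS : e / 2 < err (D i) (O m S)
  · simp only [Set.indicator_apply, Set.mem_ofPred_eq, hS, if_true, Pi.one_apply]
    exact prob_le_one.trans le_add_self
  · exact (measure_notMem_fastTest_le D hn hne (hO.measurable_apply S) i (not_lt.1 hS)).trans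
      le_self_add

/-- The test accepts player `i` in spite of a large error. -/
def Missed (O : Oracle X) (D : Fin k → Measure (X × Bool)) (e : ℝ) (i : Fin k)
    (ρ : RoundData X k m n) : Prop :=
  e < err (D i) (O m ρ.1) ∧ i ∈ fastTest e (O m ρ.1) ρ.2

lemma measurableSet_missed (hO : IsMeasurableOracle O) (e : ℝ) (i : Fin k) :
    MeasurableSet {ρ : RoundData X k m n | Missed O D e i ρ} :=
  (measurableSet_lt measurable_const ((hO.measurable_err (D i)).comp measurable_fst)).inter
    (measurableSet_fastTest hO e i)

/-- Given the training sample the classifier is fixed and the test samples are fresh, so this is the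
error of the test alone, whether or not learning succeeded. -/
lemma roundLaw_missed_le (hO : IsMeasurableOracle O) {w : Fin k → ℕ}
    (hw : ∑ j, w j ≠ 0) {e : ℝ} (hn : 0 < n) (hne : 148 ≤ n * e) (i : Fin k) :
    roundLaw m n D w {ρ | Missed O D e i ρ} ≤ 1 / 64 := by
  have := isProbabilityMeasure_mixture D w hw
  rw [roundLaw, Measure.prod_apply (measurableSet_missed D hO e i)]
  calc _ ≤ ∫⁻ _, 1 / 64 ∂(Measure.pi fun _ : Fin m => mixture D w) :=
        lintegral_mono fun S => ?_
    _ = _ := by simp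
  by_cases hS : e < err (D i) (O m S)
  · exact (measure_mono fun T hT => hT.2).trans
      (measure_mem_fastTest_le D hn hne (hO.measurable_apply S) i hS.le)
  · have : Prod.mk S ⁻¹' {ρ : RoundData X k m n | Missed O D e i ρ} = ∅ := by
      ext T
      simp [Missed, hS]
    simp [this]

/-- In expectation, at most `9 / 64` of the weight belongs to players with large error. -/
lemma sum_weight_mul_measure_le (hO : IsMeasurableOracle O) {w : Fin k → ℕ}
    (hw : ∑ j, w j ≠ 0) {e : ℝ} (he : 0 < e)
    (hlearn : (Measure.pi fun _ : Fin m => mixture D w)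
      {S | e / 16 < err (mixture D w) (O m S)} ≤ 1 / 64) :
    ∑ i, (w i : ℝ≥0∞) * (Measure.pi fun _ : Fin m => mixture D w)
      {S | e / 2 < err (D i) (O m S)} ≤ (1 / 8 + 1 / 64) * ∑ i, (w i : ℝ≥0∞) := by
  have := isProbabilityMeasure_mixture D w hw
  set P := Measure.pi fun _ : Fin m => mixture D w with hP
  have hE : ∀ i, MeasurableSet {S : Sample X m | e / 2 < err (D i) (O m S)} := fun i =>
    measurableSet_lt measurable_const (hO.measurable_err (D i))
  have hM : MeasurableSet {S : Sample X m | e / 16 < err (mixture D w) (O m S)} :=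
    measurableSet_lt measurable_const (hO.measurable_err _)
  have h1 : ∑ i, (w i : ℝ≥0∞) * P {S | e / 2 < err (D i) (O m S)} =
      ∫⁻ S, ∑ i, (w i : ℝ≥0∞) *
        {S : Sample X m | e / 2 < err (D i) (O m S)}.indicator 1 S ∂P := by
    rw [lintegral_finsetSum _ fun i _ => (measurable_one.indicator (hE i)).const_mul _]
    refine Finset.sum_congr rfl fun i _ => ?_
    rw [lintegral_const_mul _ (measurable_one.indicator (hE i)), lintegral_indicator_one (hE i)]
  rw [h1]
  calc _ ≤ ∫⁻ S, (1 / 8 + {S : Sample X m | e / 16 < err (mixture D w) (O m S)}.indicator 1 S) *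
        ∑ i, (w i : ℝ≥0∞) ∂P := lintegral_mono fun S => ?_
    _ = (1 / 8 + P {S | e / 16 < err (mixture D w) (O m S)}) * ∑ i, (w i : ℝ≥0∞) := by
      rw [lintegral_mul_const' _ _ (ENNReal.sum_ne_top.2 fun i _ => ENNReal.natCast_ne_top _),
        lintegral_add_left measurable_const, lintegral_indicator_one hM]
      simp
    _ ≤ _ := by gcongr
  -- If learning fails, all of the weight may be bad; this has probability at most `1 / 64`.
  -- Otherwise at most an eighth is bad.
  by_cases hS : e / 16 < err (mixture D w) (O m S)
  · calc _ ≤ 1 * ∑ i, (w i : ℝ≥0∞) := by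
          rw [one_mul]
          refine Finset.sum_le_sum fun i _ => mul_le_of_le_one_right' ?_
          exact Set.indicator_le_self' (by simp) S
      _ ≤ _ := by
          gcongr
          simp [hS]
  · have h := ENNReal.ofReal_le_ofReal (sum_weight_ite_le D w hw he (not_lt.1 hS))
    rw [ENNReal.ofReal_mul (by norm_num), ENNReal.ofReal_sum_of_nonneg (by intros; positivity),
      ENNReal.ofReal_sum_of_nonneg (by intros; positivity)] at h
    have h8 : ENNReal.ofReal (1 / 8) = 1 / 8 := by
      rw [ENNReal.ofReal_div_of_pos (by norm_num)]; simp
    simp only [ENNReal.ofReal_mul (Nat.cast_nonneg _), ENNReal.ofReal_natCast, h8] at h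
    simp only [Set.indicator_apply, Set.mem_ofPred_eq, hS, if_false, add_zero, Pi.one_apply]
    refine le_trans (le_of_eq (Finset.sum_congr rfl fun i _ => ?_)) h
    split_ifs <;> simp

end Round

/-! ### The multiplicative weights loop -/

section Loop

lemma card_filter_univ_castSucc {r : ℕ} (p : Fin (r + 1) → Prop) [DecidablePred p] :
    (Finset.univ.filter p).card =
      (Finset.univ.filter fun j : Fin r => p j.castSucc).card + if p (Fin.last r) then 1 else 0 := by
  simp only [Finset.card_filter, Fin.sum_univ_castSucc]

variable {X : Type*} {O : Oracle X} {k m n : ℕ} {e : ℝ}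

open Classical in
lemma weights_snoc (r : ℕ) (h : Fin r → RoundData X k m n) (ρ : RoundData X k m n) (i : Fin k) :
    weights O e (r + 1) (Fin.snoc h ρ : Fin (r + 1) → RoundData X k m n) i =
      if i ∈ fastTest e (O m ρ.1) ρ.2 then weights O e r h i else 2 * weights O e r h i := by
  simp [weights]

open Classical in
lemma weights_eq_pow (r : ℕ) (h : Fin r → RoundData X k m n) (i : Fin k) :
    weights O e r h i =
      2 ^ (Finset.univ.filter fun j => i ∉ fastTest e (O m (h j).1) (h j).2).card := by
  induction r with
  | zero => simp [weights]
  | succ r ih =>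
    rw [weights]
    simp only [ih, card_filter_univ_castSucc, pow_add]
    split_ifs <;> simp_all [mul_comm, pow_succ]

lemma sum_weights_ne_zero (hk : 1 ≤ k) (r : ℕ) (h : Fin r → RoundData X k m n) :
    ∑ i, weights O e r h i ≠ 0 := by
  classical
  intro h0
  have := Finset.sum_eq_zero_iff.1 h0 ⟨0, hk⟩ (Finset.mem_univ _)
  rw [weights_eq_pow] at this
  simp at this

variable [MeasurableSpace X]

lemma measurable_weights (hO : IsMeasurableOracle O) (r : ℕ) :
    Measurable fun h : Fin r → RoundData X k m n => weights O e r h := by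
  classical
  induction r with
  | zero => exact measurable_const
  | succ r ih =>
    refine measurable_pi_lambda _ fun i => ?_
    have hG : MeasurableSet {h : Fin (r + 1) → RoundData X k m n |
        i ∈ fastTest e (O m (h (Fin.last r)).1) (h (Fin.last r)).2} :=
      (measurable_pi_apply (Fin.last r) :
        Measurable fun h : Fin (r + 1) → RoundData X k m n => h (Fin.last r))
        (measurableSet_fastTest (m := m) (n := n) hO e i)
    have hw : Measurable fun h : Fin (r + 1) → RoundData X k m n =>
        weights O e r (fun j => h j.castSucc) i :=
      (measurable_pi_apply i).comp (ih.comp (measurable_pi_lambda _ fun j =>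
        measurable_pi_apply j.castSucc))
    exact Measurable.ite hG hw (hw.const_mul 2)

variable (D : Fin k → Measure (X × Bool))

/-- A potential that grows in expectation by a factor of at most `c` in every round. -/
lemma lintegral_transcriptLaw_le (V : (r : ℕ) → (Fin r → RoundData X k m n) → ℝ≥0∞) (c : ℝ≥0∞)
    (hc : c ≠ ∞)
    (hV : ∀ r h, ∫⁻ ρ, V (r + 1) (Fin.snoc h ρ) ∂(roundLaw m n D (weights O e r h)) ≤ c * V r h)
    (r : ℕ) :
    ∫⁻ h, V r h ∂(transcriptLaw m n O e D r) ≤ c ^ r * V 0 Fin.elim0 := by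
  induction r with
  | zero =>
    rw [transcriptLaw, lintegral_dirac, pow_zero, one_mul]
  | succ r ih =>
    rw [transcriptLaw]
    -- Only upper bounds are wanted, and these hold for `bind` and `map` without measurability.
    calc _ ≤ _ := Measure.lintegral_bind_le _ _ _
      _ ≤ ∫⁻ h, c * V r h ∂(transcriptLaw m n O e D r) :=
        lintegral_mono fun h => (lintegral_map_le _ _).trans (hV r h)
      _ = c * ∫⁻ h, V r h ∂(transcriptLaw m n O e D r) := lintegral_const_mul' _ _ hc
      _ ≤ _ := by
        rw [pow_succ', mul_assoc]
        gcongr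

variable [∀ i, IsProbabilityMeasure (D i)]

lemma measurable_snoc {α : Type*} [MeasurableSpace α] (r : ℕ) :
    Measurable fun q : (Fin r → α) × α => (Fin.snoc q.1 q.2 : Fin (r + 1) → α) := by
  refine measurable_pi_lambda _ fun j => ?_
  refine Fin.lastCases ?_ (fun j => ?_) j
  · simpa using measurable_snd
  · simp only [Fin.snoc_castSucc]
    exact (measurable_pi_apply j).comp measurable_fst

lemma measurable_snoc_right {α : Type*} [MeasurableSpace α] {r : ℕ} (h : Fin r → α) :
    Measurable fun a : α => (Fin.snoc h a : Fin (r + 1) → α) :=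
  (measurable_snoc r).comp measurable_prodMk_left

/-- The past enters the law of the next round only through the weights, which take countably many
values; joint measurability may therefore be checked for each value separately. -/
lemma measurable_map_snoc {α ι : Type*} [MeasurableSpace α] [MeasurableSpace ι] [Countable ι]
    [MeasurableSingletonClass ι] {r : ℕ} (κ : ι → Measure α) [∀ w, IsFiniteMeasure (κ w)]
    {g : (Fin r → α) → ι} (hg : Measurable g) :
    Measurable fun h : Fin r → α =>
      (κ (g h)).map fun a => (Fin.snoc h a : Fin (r + 1) → α) := by
  refine Measure.measurable_of_measurable_coe _ fun s hs => ?_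
  simp_rw [Measure.map_apply (measurable_snoc_right _) hs]
  have hf : Measurable fun q : ι × (Fin r → α) =>
      κ q.1 ((fun a => (Fin.snoc q.2 a : Fin (r + 1) → α)) ⁻¹' s) :=
    measurable_from_prod_countable_right fun w =>
      measurable_measure_prodMk_left (ν := κ w) (measurable_snoc r hs)
  exact hf.comp (hg.prodMk measurable_id)

lemma measurable_map_snoc_roundLaw (hO : IsMeasurableOracle O) (r : ℕ) :
    Measurable fun h : Fin r → RoundData X k m n =>
      (roundLaw m n D (weights O e r h)).map fun ρ =>
        (Fin.snoc h ρ : Fin (r + 1) → RoundData X k m n) :=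
  measurable_map_snoc (fun w => roundLaw m n D w) (measurable_weights hO r)

lemma isProbabilityMeasure_transcriptLaw (hO : IsMeasurableOracle O) (hk : 1 ≤ k) (r : ℕ) :
    IsProbabilityMeasure (transcriptLaw m n O e D r) := by
  induction r with
  | zero => exact Measure.dirac.isProbabilityMeasure
  | succ r ih =>
    refine ⟨?_⟩
    rw [transcriptLaw, Measure.bind_apply MeasurableSet.univ
      (measurable_map_snoc_roundLaw D hO r).aemeasurable]
    have h1 : ∀ h : Fin r → RoundData X k m n, ((roundLaw m n D (weights O e r h)).map fun ρ =>
        (Fin.snoc h ρ : Fin (r + 1) → RoundData X k m n)) Set.univ = 1 := by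
      intro h
      have := isProbabilityMeasure_roundLaw (m := m) (n := n) D
        (sum_weights_ne_zero (O := O) (e := e) hk r h)
      rw [Measure.map_apply (measurable_snoc_right h) MeasurableSet.univ]
      simp
    simp [h1]

/-- The expected increase is the expected rejected weight: a fraction `1 / 64` from false rejections
and `1 / 8 + 1 / 64` from players on whom the classifier has error above `e / 2`. -/
lemma lintegral_sum_weights_le (hO : IsMeasurableOracle O) (hk : 1 ≤ k) (he : 0 < e) (hn : 0 < n)
    (hne : 148 ≤ n * e)
    (hlearn : ∀ w : Fin k → ℕ, ∑ i, w i ≠ 0 → (Measure.pi fun _ : Fin m => mixture D w)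
      {S | e / 16 < err (mixture D w) (O m S)} ≤ 1 / 64) (r : ℕ) :
    ∫⁻ h, ∑ i, (weights O e r h i : ℝ≥0∞) ∂(transcriptLaw m n O e D r) ≤
      (1 + 1 / 64 + (1 / 8 + 1 / 64)) ^ r * k := by
  classical
  refine (lintegral_transcriptLaw_le D (fun r h => ∑ i, (weights O e r h i : ℝ≥0∞))
    (1 + 1 / 64 + (1 / 8 + 1 / 64)) (by finiteness) (fun r h => ?_) r).trans ?_
  · have hw := sum_weights_ne_zero (O := O) (e := e) hk r h
    set w := weights O e r h with hwdef
    have := isProbabilityMeasure_roundLaw (m := m) (n := n) D hw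
    have hB : ∀ i, MeasurableSet {ρ : RoundData X k m n | i ∉ fastTest e (O m ρ.1) ρ.2} :=
      fun i => (measurableSet_fastTest hO e i).compl
    have h1 : ∀ ρ : RoundData X k m n, ∑ i, (weights O e (r + 1)
        (Fin.snoc h ρ : Fin (r + 1) → RoundData X k m n) i : ℝ≥0∞) =
        ∑ i, (w i : ℝ≥0∞) *
          (1 + {ρ : RoundData X k m n | i ∉ fastTest e (O m ρ.1) ρ.2}.indicator 1 ρ) := by
      intro ρ
      refine Finset.sum_congr rfl fun i _ => ?_
      rw [weights_snoc]
      by_cases hi : i ∈ fastTest e (O m ρ.1) ρ.2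
      · simp [hi, hwdef]
      · simp only [hi, if_false, Set.indicator_apply, Set.mem_ofPred_eq, not_false_eq_true, if_true,
          Pi.one_apply, hwdef]
        push_cast
        ring
    simp only [h1]
    have hm : ∀ i, Measurable fun ρ : RoundData X k m n => (w i : ℝ≥0∞) *
        (1 + {ρ : RoundData X k m n | i ∉ fastTest e (O m ρ.1) ρ.2}.indicator 1 ρ) := fun i =>
      ((measurable_one.indicator (hB i)).const_add 1).const_mul _
    rw [lintegral_finsetSum _ fun i _ => hm i]
    calc _ = ∑ i, (w i : ℝ≥0∞) *
          (1 + roundLaw m n D w {ρ | i ∉ fastTest e (O m ρ.1) ρ.2}) := by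
          refine Finset.sum_congr rfl fun i _ => ?_
          rw [lintegral_const_mul' _ _ (ENNReal.natCast_ne_top _),
            lintegral_add_left measurable_const, lintegral_indicator_one (hB i)]
          simp
      _ ≤ ∑ i, (w i : ℝ≥0∞) * (1 + (1 / 64 + (Measure.pi fun _ : Fin m => mixture D w)
            {S | e / 2 < err (D i) (O m S)})) := by
          gcongr with i
          exact roundLaw_notMem_fastTest_le D hO hw hn hne i
      _ = (1 + 1 / 64) * ∑ i, (w i : ℝ≥0∞) + ∑ i, (w i : ℝ≥0∞) *
            (Measure.pi fun _ : Fin m => mixture D w) {S | e / 2 < err (D i) (O m S)} := by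
          rw [Finset.mul_sum, ← Finset.sum_add_distrib]
          refine Finset.sum_congr rfl fun i _ => ?_
          ring
      _ ≤ _ := by
          rw [add_mul _ (1 / 8 + 1 / 64)]
          gcongr
          exact sum_weight_mul_measure_le D hO hw he (hlearn w hw)
  · simp [weights]

-- The exponential moment replaces independence: rounds depend on one another through the weights,
-- but each multiplies the moment by at most `1 + 1 / 64` conditionally on the past.
open Classical in
lemma lintegral_two_pow_missed_le (hO : IsMeasurableOracle O) (hk : 1 ≤ k) (hn : 0 < n)
    (hne : 148 ≤ n * e) (i : Fin k) (r : ℕ) :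
    ∫⁻ h, 2 ^ (Finset.univ.filter fun j => Missed O D e i (h j)).card
      ∂(transcriptLaw m n O e D r) ≤ (1 + 1 / 64) ^ r := by
  refine (lintegral_transcriptLaw_le D
    (fun r h => 2 ^ (Finset.univ.filter fun j => Missed O D e i (h j)).card)
    (1 + 1 / 64) (by finiteness) (fun r h => ?_) r).trans ?_
  · have hw := sum_weights_ne_zero (O := O) (e := e) hk r h
    have := isProbabilityMeasure_roundLaw (m := m) (n := n) D hw
    have hB := measurableSet_missed (m := m) (n := n) D hO e i
    have h1 : ∀ ρ : RoundData X k m n, (2 : ℝ≥0∞) ^ (Finset.univ.filter fun j =>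
        Missed O D e i ((Fin.snoc h ρ : Fin (r + 1) → RoundData X k m n) j)).card =
        2 ^ (Finset.univ.filter fun j => Missed O D e i (h j)).card *
          (1 + {ρ : RoundData X k m n | Missed O D e i ρ}.indicator 1 ρ) := by
      intro ρ
      simp only [card_filter_univ_castSucc, Fin.snoc_castSucc, Fin.snoc_last, pow_add]
      by_cases hi : Missed O D e i ρ
      · simp [hi, one_add_one_eq_two, pow_succ]
      · simp [hi]
    simp only [h1]
    rw [lintegral_const_mul' _ _ (by finiteness), lintegral_add_left measurable_const,
      lintegral_indicator_one hB, mul_comm]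
    gcongr
    rw [lintegral_const, measure_univ, mul_one]
    exact roundLaw_missed_le D hO hw hn hne i
  · simp

end Loop

/-! ### The majority vote -/

section Majority

lemma le_two_mul_card_of_maj_ne {X : Type*} {t : ℕ} (f : Fin t → X → Bool) {x : X} {y : Bool}
    (h : maj f x ≠ y) : t ≤ 2 * (Finset.univ.filter fun r => f r x ≠ y).card := by
  have hsplit := Finset.card_filter_add_card_filter_not (s := Finset.univ) fun r => f r x = true
  rw [Finset.card_univ, Fintype.card_fin] at hsplit
  cases y
  · have h1 : t < 2 * (Finset.univ.filter fun r => f r x = true).card := by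
      simpa [maj] using h
    simpa using h1.le
  · have h1 : 2 * (Finset.univ.filter fun r => f r x = true).card ≤ t := by
      simpa [maj] using h
    simp only [ne_eq]
    omega

/-- If at most two fifths of the classifiers have error above `e`, their majority has error at most
`6 * e`. -/
lemma err_maj_le {X : Type*} [MeasurableSpace X] (μ : Measure (X × Bool)) [IsProbabilityMeasure μ]
    {L t : ℕ} (hL : 0 < L) (ht : t = 150 * L) {e : ℝ} (he : 0 ≤ e) {f : Fin t → X → Bool}
    (hf : ∀ r, Measurable (f r))
    (hbad : (Finset.univ.filter fun r => e < err μ (f r)).card ≤ 60 * L) :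
    err μ (maj f) ≤ 6 * e := by
  set G := Finset.univ.filter fun r => ¬ e < err μ (f r) with hG
  set b := (Finset.univ.filter fun r => e < err μ (f r)).card with hb
  have hcard : b + G.card = 150 * L := by
    rw [hb, hG, Finset.card_filter_add_card_filter_not, Finset.card_univ, Fintype.card_fin, ht]
  have hA : ∀ r, MeasurableSet {p : X × Bool | f r p.1 ≠ p.2} := fun r =>
    measurableSet_errors (hf r)
  set φ : X × Bool → ℝ := fun p => ∑ r ∈ G, {p : X × Bool | f r p.1 ≠ p.2}.indicator 1 p with hφ
  have hint : ∀ r ∈ G, Integrable ({p : X × Bool | f r p.1 ≠ p.2}.indicator (1 : X × Bool → ℝ)) μ :=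
    fun r _ => (integrable_const (1 : ℝ)).indicator (hA r)
  have hφint : ∫ p, φ p ∂μ = ∑ r ∈ G, err μ (f r) := by
    rw [hφ, integral_finsetSum _ hint]
    exact Finset.sum_congr rfl fun r _ => integral_indicator_one (hA r)
  have hmarkov := mul_meas_ge_le_integral_of_nonneg (μ := μ) (f := φ)
    (.of_forall fun p => Finset.sum_nonneg fun r _ => Set.indicator_nonneg (by simp) p)
    (integrable_finsetSum _ hint) (75 * L - b)
  -- A wrong majority needs at least `75 L` wrong votes, of which at most `b` come from bad
  -- classifiers.
  have hsub : {p : X × Bool | maj f p.1 ≠ p.2} ⊆ {p | (75 * L - b : ℝ) ≤ φ p} := by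
    intro p hp
    have h1 := le_two_mul_card_of_maj_ne f hp
    have h2 : φ p = ((Finset.univ.filter fun r => f r p.1 ≠ p.2) ∩ G).card := by
      rw [Finset.filter_inter, Finset.univ_inter, Finset.card_filter]
      simp [hφ, Set.indicator_apply]
    have h3 : (Finset.univ.filter fun r => f r p.1 ≠ p.2).card ≤
        ((Finset.univ.filter fun r => f r p.1 ≠ p.2) ∩ G).card + b := by
      rw [hb, ← Finset.card_inter_add_card_sdiff (Finset.univ.filter fun r => f r p.1 ≠ p.2) G]
      gcongr
      intro r hr
      have := (Finset.mem_sdiff.1 hr).2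
      simpa [hG] using this
    have h4 : 75 * L ≤ ((Finset.univ.filter fun r => f r p.1 ≠ p.2) ∩ G).card + b := by omega
    have h5 : (75 * L : ℝ) ≤ (((Finset.univ.filter fun r => f r p.1 ≠ p.2) ∩ G).card : ℝ) + b := by
      exact_mod_cast h4
    change (75 * L - b : ℝ) ≤ φ p
    linarith
  have hsum : ∑ r ∈ G, err μ (f r) ≤ G.card * e := by
    rw [← nsmul_eq_mul]
    refine Finset.sum_le_card_nsmul _ _ _ fun r hr => ?_
    simpa [hG] using hr
  have herr : err μ (maj f) ≤ μ.real {p | (75 * L - b : ℝ) ≤ φ p} := measureReal_mono hsub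
  have hb' : (b : ℝ) ≤ 60 * L := by exact_mod_cast hbad
  have hc' : (b : ℝ) + G.card = 150 * L := by exact_mod_cast hcard
  have hL' : (0 : ℝ) < L := by exact_mod_cast hL
  have hpos : 0 < (75 * L - b : ℝ) := by linarith
  have h6 : (75 * L - b : ℝ) * err μ (maj f) ≤ (150 * L - b) * e := by
    have := mul_le_mul_of_nonneg_left herr hpos.le
    rw [hφint] at hmarkov
    have hG' : (G.card : ℝ) = 150 * L - b := by linarith
    rw [hG'] at hsum
    linarith
  -- `(150 L - b) / (75 L - b)` increases with `b` and equals `90 / 15 = 6` at `b = 60 L`.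
  refine le_of_mul_le_mul_left (h6.trans ?_) hpos
  nlinarith

end Majority

/-! ### Correctness -/

section Correctness

/-- If a potential grows by at most `2 ^ a` per `150` rounds and the threshold by `2 ^ (a + 2)`,
Markov's inequality leaves a gain of `4 ^ L`. -/
lemma two_pow_mul_le_of_markov {P x c : ℝ≥0∞} {a L : ℕ} (hx : x ^ 150 ≤ 2 ^ a)
    (h : 2 ^ ((a + 2) * L) * P ≤ x ^ (150 * L) * c) : 2 ^ (2 * L) * P ≤ c := by
  refine (ENNReal.mul_le_mul_iff_right (a := 2 ^ (a * L)) (by simp) (by finiteness)).1 ?_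
  rw [← mul_assoc, ← pow_add, ← add_mul]
  refine h.trans ?_
  rw [pow_mul, pow_mul]
  gcongr

variable {X : Type*} [MeasurableSpace X] {O : Oracle X} {k m n : ℕ} {e : ℝ}

open Classical in
lemma measurable_two_pow_missed (D : Fin k → Measure (X × Bool)) [∀ i, IsProbabilityMeasure (D i)]
    (hO : IsMeasurableOracle O) (i : Fin k) {t : ℕ} :
    Measurable fun h : Fin t → RoundData X k m n =>
      (2 : ℝ≥0∞) ^ (Finset.univ.filter fun j => Missed O D e i (h j)).card := by
  have h2 : ∀ h : Fin t → RoundData X k m n,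
      (2 : ℝ≥0∞) ^ (Finset.univ.filter fun j => Missed O D e i (h j)).card =
        ∏ j, if Missed O D e i (h j) then 2 else 1 := by
    intro h
    rw [Finset.prod_ite, Finset.prod_const, Finset.prod_const_one, mul_one]
  simp only [h2]
  refine Finset.measurable_prod _ fun j _ => ?_
  exact Measurable.ite ((measurable_pi_apply j : Measurable fun h : Fin t → RoundData X k m n =>
    h j) (measurableSet_missed D hO e i)) measurable_const measurable_const

/-- With probability `1 - 2 k / 4 ^ L` the majority of `150 * L` rounds has error at most `6 * e` on
every player, if the learner has error at most `e / 16` on every mixture with high probability. -/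
theorem transcriptLaw_fail_le (D : Fin k → Measure (X × Bool)) [∀ i, IsProbabilityMeasure (D i)]
    (hO : IsMeasurableOracle O) (hk : 1 ≤ k) (he : 0 < e) (hn : 0 < n) (hne : 148 ≤ n * e)
    (hlearn : ∀ w : Fin k → ℕ, ∑ i, w i ≠ 0 → (Measure.pi fun _ : Fin m => mixture D w)
      {S | e / 16 < err (mixture D w) (O m S)} ≤ 1 / 64) {L t : ℕ} (hL : 0 < L)
    (ht : t = 150 * L) :
    2 ^ (2 * L) * transcriptLaw m n O e D t {h | ¬ ∀ i, err (D i) (output O h) ≤ 6 * e} ≤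
      2 * k := by
  classical
  set Q := transcriptLaw m n O e D t with hQ
  -- The thresholds split the budget of bad rounds as `60 L = 45 L + 15 L`, rejections plus misses.
  set U : Set (Fin t → RoundData X k m n) :=
    {h | 2 ^ (45 * L) ≤ ∑ i, (weights O e t h i : ℝ≥0∞)} with hU
  set V : Fin k → Set (Fin t → RoundData X k m n) := fun i =>
    {h | 2 ^ (15 * L) ≤ (2 : ℝ≥0∞) ^ (Finset.univ.filter fun j => Missed O D e i (h j)).card}
    with hV
  have hsub : {h : Fin t → RoundData X k m n | ¬ ∀ i, err (D i) (output O h) ≤ 6 * e} ⊆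
      U ∪ ⋃ i, V i := by
    intro h hh
    simp only [Set.mem_ofPred_eq, not_forall] at hh
    obtain ⟨i, hi⟩ := hh
    have hbad : 60 * L < (Finset.univ.filter fun r => e < err (D i) (O m (h r).1)).card := by
      by_contra hc
      exact hi (err_maj_le (D i) hL ht he.le (fun r => hO.measurable_apply _) (not_lt.1 hc))
    have hle : (Finset.univ.filter fun r => e < err (D i) (O m (h r).1)).card ≤
        (Finset.univ.filter fun j => i ∉ fastTest e (O m (h j).1) (h j).2).card +
        (Finset.univ.filter fun j => Missed O D e i (h j)).card := by
      refine (Finset.card_le_card fun r hr => ?_).trans (Finset.card_union_le _ _)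
      by_cases hG : i ∈ fastTest e (O m (h r).1) (h r).2
      · exact Finset.mem_union_right _
          (Finset.mem_filter.2 ⟨Finset.mem_univ _, (Finset.mem_filter.1 hr).2, hG⟩)
      · exact Finset.mem_union_left _ (Finset.mem_filter.2 ⟨Finset.mem_univ _, hG⟩)
    by_cases hm : 15 * L ≤ (Finset.univ.filter fun j => Missed O D e i (h j)).card
    · refine Or.inr (Set.mem_iUnion.2 ⟨i, ?_⟩)
      exact pow_le_pow_right₀ (one_le_two (α := ℝ≥0∞)) hm
    · refine Or.inl ?_
      change (2 : ℝ≥0∞) ^ (45 * L) ≤ _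
      calc (2 : ℝ≥0∞) ^ (45 * L) ≤
            2 ^ (Finset.univ.filter fun j => i ∉ fastTest e (O m (h j).1) (h j).2).card :=
            pow_le_pow_right₀ one_le_two (by omega)
        _ = (weights O e t h i : ℝ≥0∞) := by rw [weights_eq_pow]; push_cast; rfl
        _ ≤ _ := Finset.single_le_sum (f := fun i => (weights O e t h i : ℝ≥0∞))
            (fun _ _ => zero_le) (Finset.mem_univ i)
  have hUle : 2 ^ (2 * L) * Q U ≤ k := by
    -- `43 = 45 - 2`, and `(37 / 32) ^ 150 ≤ 2 ^ 43`.
    refine two_pow_mul_le_of_markov (a := 43) (x := 1 + 1 / 64 + (1 / 8 + 1 / 64)) ?_ ?_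
    · have : (1 + 1 / 64 + (1 / 8 + 1 / 64) : ℝ≥0∞) = ENNReal.ofReal (37 / 32) := by
        rw [show (37 / 32 : ℝ) = 1 + 1 / 64 + (1 / 8 + 1 / 64) by norm_num]
        repeat rw [ENNReal.ofReal_add (by norm_num) (by norm_num)]
        simp
      rw [this, ← ENNReal.ofReal_pow (by norm_num), ← ENNReal.ofReal_ofNat 2,
        ← ENNReal.ofReal_pow (by norm_num)]
      exact ENNReal.ofReal_le_ofReal (by norm_num)
    · have hmeas : Measurable fun h : Fin t → RoundData X k m n =>
          ∑ i, (weights O e t h i : ℝ≥0∞) :=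
        Finset.measurable_sum _ fun i _ => (measurable_of_countable (fun w : ℕ => (w : ℝ≥0∞))).comp
          ((measurable_pi_apply i).comp (measurable_weights hO t))
      rw [← ht]
      exact (mul_meas_ge_le_lintegral hmeas _).trans
        (lintegral_sum_weights_le D hO hk he hn hne hlearn t)
  have hVle : ∀ i, 2 ^ (2 * L) * Q (V i) ≤ 1 := by
    intro i
    -- `13 = 15 - 2`, and `(65 / 64) ^ 150 ≤ 2 ^ 13`.
    refine two_pow_mul_le_of_markov (a := 13) (x := 1 + 1 / 64) ?_ ?_
    · have : (1 + 1 / 64 : ℝ≥0∞) = ENNReal.ofReal (65 / 64) := by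
        rw [show (65 / 64 : ℝ) = 1 + 1 / 64 by norm_num,
          ENNReal.ofReal_add (by norm_num) (by norm_num)]
        simp
      rw [this, ← ENNReal.ofReal_pow (by norm_num), ← ENNReal.ofReal_ofNat 2,
        ← ENNReal.ofReal_pow (by norm_num)]
      exact ENNReal.ofReal_le_ofReal (by norm_num)
    · have hmeas : Measurable fun h : Fin t → RoundData X k m n =>
          (2 : ℝ≥0∞) ^ (Finset.univ.filter fun j => Missed O D e i (h j)).card :=
        measurable_two_pow_missed D hO i
      rw [← ht, mul_one]
      exact (mul_meas_ge_le_lintegral hmeas _).trans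
        (lintegral_two_pow_missed_le D hO hk hn hne i t)
  calc _ ≤ 2 ^ (2 * L) * (Q U + ∑ i, Q (V i)) := by
        gcongr
        exact (measure_mono hsub).trans ((measure_union_le _ _).trans
          (by gcongr; exact measure_iUnion_fintype_le _ _))
    _ = 2 ^ (2 * L) * Q U + ∑ i, 2 ^ (2 * L) * Q (V i) := by rw [mul_add, Finset.mul_sum]
    _ ≤ k + ∑ _i : Fin k, 1 := by
        gcongr with i
        exact hVle i
    _ = 2 * k := by simp [two_mul]

end Correctness

/-! ### Algorithm R2 -/

section AlgorithmR2

lemma one_lt_div_delta {k : ℕ} (hk : 1 ≤ k) {δ : ℝ} (hδ : 0 < δ) (hδ1 : δ < 1) :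
    1 < (k : ℝ) / δ := by
  rw [lt_div_iff₀ hδ, one_mul]
  exact hδ1.trans_le (by exact_mod_cast hk)

lemma ceil_logb_pos {k : ℕ} (hk : 1 ≤ k) {δ : ℝ} (hδ : 0 < δ) (hδ1 : δ < 1) :
    0 < ⌈Real.logb 2 (k / δ)⌉₊ :=
  Nat.ceil_pos.2 (Real.logb_pos one_lt_two (one_lt_div_delta hk hδ hδ1))

lemma div_delta_le_two_pow {k : ℕ} (hk : 1 ≤ k) {δ : ℝ} (hδ : 0 < δ) (hδ1 : δ < 1) :
    (k : ℝ) / δ ≤ 2 ^ ⌈Real.logb 2 (k / δ)⌉₊ := by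
  have h := Nat.le_ceil (Real.logb 2 (k / δ))
  rw [Real.logb_le_iff_le_rpow one_lt_two (by linarith [one_lt_div_delta hk hδ hδ1]),
    Real.rpow_natCast] at h
  exact h

lemma le_mixSize_mul {C₁ : ℝ} (d k : ℕ) {ε : ℝ} (δ : ℝ) (hε : 0 < ε) :
    C₁ * (d * Real.log (1 / (ε / 6 / 16)) + Real.log (1 / (δ / (4 * rounds k δ)))) ≤
      mixSize C₁ d k ε δ * (ε / 6 / 16) := by
  rw [← div_le_iff₀ (by positivity)]
  refine le_trans (le_of_eq ?_) (Nat.le_ceil _)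
  ring

theorem lawR2_ge {X : Type*} [MeasurableSpace X] {F : Set (X → Bool)} {d : ℕ} {O : Oracle X}
    {k : ℕ} {D : Fin k → Measure (X × Bool)} {ε δ C₁ C₂ : ℝ} (hC₁ : 50 ≤ C₁) (hC₂ : 148 ≤ C₂)
    (hF : vcDim F = d) (hO : IsERM F O) (hOm : IsMeasurableOracle O) (hk : 1 ≤ k)
    (hD : ∀ i, IsProbabilityMeasure (D i)) (hreal : Realizable F D) (hε : 0 < ε) (hε1 : ε < 1)
    (hδ : 0 < δ) (hδ1 : δ < 1) :
    ENNReal.ofReal (1 - δ) ≤ lawR2 C₁ C₂ d O D ε δ {h | ∀ i, err (D i) (output O h) ≤ ε} := by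
  obtain ⟨g, hg, hgD⟩ := hreal
  set L := ⌈Real.logb 2 (k / δ)⌉₊ with hLdef
  have hL : 0 < L := ceil_logb_pos hk hδ hδ1
  have hkL : (k : ℝ) / δ ≤ 2 ^ L := div_delta_le_two_pow hk hδ hδ1
  have hrounds : rounds k δ = 150 * L := rfl
  have hrR : (150 : ℝ) ≤ rounds k δ := by
    rw [hrounds]
    exact_mod_cast Nat.le_mul_of_pos_right 150 hL
  set δ' := δ / (4 * rounds k δ) with hδ'
  have hδ'0 : 0 < δ' := by positivity
  have hδ'64 : δ' ≤ 1 / 64 := by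
    rw [hδ', div_le_div_iff₀ (by positivity) (by norm_num)]
    linarith
  have hn0 : 148 / (ε / 6) ≤ testSize C₂ ε :=
    le_trans (by gcongr) (Nat.le_ceil (C₂ / (ε / 6)))
  have hne : 148 ≤ testSize C₂ ε * (ε / 6) := by rwa [div_le_iff₀ (by positivity)] at hn0
  have hn : 0 < testSize C₂ ε := by
    have : (0 : ℝ) < testSize C₂ ε := lt_of_lt_of_le (by positivity) hn0
    exact_mod_cast this
  have hm := le_mixSize_mul (C₁ := C₁) d k δ hε
  rw [← hδ'] at hm
  have hlogs : 0 ≤ d * Real.log (1 / (ε / 6 / 16)) + Real.log (1 / δ') := by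
    have h1 : 0 ≤ Real.log (1 / (ε / 6 / 16)) :=
      Real.log_nonneg (by rw [le_div_iff₀ (by positivity)]; linarith)
    have h2 := three_le_log hδ'0 hδ'64
    positivity
  have hm50 := (mul_le_mul_of_nonneg_right hC₁ hlogs).trans hm
  have hlearn : ∀ w : Fin k → ℕ, ∑ i, w i ≠ 0 →
      (Measure.pi fun _ : Fin (mixSize C₁ d k ε δ) => mixture D w)
        {S | ε / 6 / 16 < err (mixture D w) (O _ S)} ≤ 1 / 64 := by
    intro w hw
    have := isProbabilityMeasure_mixture D w hw
    refine (measure_err_lt_le hF hO hOm (mixture D w) hg (err_mixture_eq_zero D w hgD hw)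
      (by positivity) (by linarith) hδ'0 hδ'64 hm50).trans ?_
    refine (ENNReal.ofReal_le_ofReal hδ'64).trans ?_
    rw [ENNReal.ofReal_div_of_pos (by norm_num)]
    simp
  have hfail := transcriptLaw_fail_le D hOm hk (by positivity : 0 < ε / 6) hn hne hlearn hL hrounds
  rw [show 6 * (ε / 6) = ε by ring] at hfail
  have hP := isProbabilityMeasure_transcriptLaw (m := mixSize C₁ d k ε δ) (n := testSize C₂ ε)
    (e := ε / 6) D hOm hk (rounds k δ)
  unfold lawR2
  set Q := transcriptLaw (mixSize C₁ d k ε δ) (testSize C₂ ε) O (ε / 6) D (rounds k δ) with hQ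
  set A := {h : Fin (rounds k δ) → RoundData X k (mixSize C₁ d k ε δ) (testSize C₂ ε) |
    ∀ i, err (D i) (output O h) ≤ ε} with hA
  change 2 ^ (2 * L) * Q Aᶜ ≤ 2 * k at hfail
  have hAc : Q Aᶜ ≤ ENNReal.ofReal δ := by
    -- One factor `2 ^ L` is at least `k / δ`; the other absorbs the `2`.
    have h2k : (2 * k : ℝ) ≤ 2 ^ (2 * L) * δ := by
      rw [div_le_iff₀ hδ] at hkL
      have h2L : (2 : ℝ) ≤ 2 ^ L := by
        simpa using pow_le_pow_right₀ (one_le_two (α := ℝ)) hL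
      calc (2 * k : ℝ) ≤ 2 ^ L * (2 ^ L * δ) := by gcongr
        _ = _ := by ring
    have h2k' := ENNReal.ofReal_le_ofReal h2k
    rw [ENNReal.ofReal_mul (by norm_num), ENNReal.ofReal_mul (by positivity),
      ENNReal.ofReal_pow (by norm_num), ENNReal.ofReal_natCast, ENNReal.ofReal_ofNat] at h2k'
    exact (ENNReal.mul_le_mul_iff_right (by simp) (by finiteness)).1 (hfail.trans h2k')
  rw [ENNReal.ofReal_sub _ hδ.le, ENNReal.ofReal_one, tsub_le_iff_right]
  calc (1 : ℝ≥0∞) = Q (A ∪ Aᶜ) := by rw [Set.union_compl_self, measure_univ]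
    _ ≤ Q A + Q Aᶜ := measure_union_le _ _
    _ ≤ _ := by gcongr

/-- The `+ 1` of the ceiling is absorbed because `ln (k / δ)` is at least `ln (1 / η) > 0`; this is
why `k / δ` must stay away from `1`. -/
lemma rounds_le {η : ℝ} (hη : 0 < η) (hη1 : η < 1) {k : ℕ} {δ : ℝ} (hδ : 0 < δ)
    (hδk : δ ≤ η * k) :
    (rounds k δ : ℝ) ≤ 150 * (1 / Real.log 2 + 1 / Real.log (1 / η)) * Real.log (k / δ) := by
  have hl2 := Real.log_pos one_lt_two
  have hlη : 0 < Real.log (1 / η) := Real.log_pos (by rw [lt_div_iff₀ hη]; linarith)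
  have hl : Real.log (1 / η) ≤ Real.log (k / δ) := by
    refine Real.log_le_log (by positivity) ?_
    rw [div_le_div_iff₀ hη hδ]
    linarith
  have h1 : (⌈Real.logb 2 (k / δ)⌉₊ : ℝ) ≤ Real.log (k / δ) / Real.log 2 + 1 :=
    (Nat.ceil_lt_add_one (div_nonneg (hlη.le.trans hl) hl2.le)).le
  have h2 : 1 ≤ Real.log (k / δ) / Real.log (1 / η) := by rwa [le_div_iff₀ hlη, one_mul]
  rw [rounds]
  push_cast
  have h3 : 150 * (1 / Real.log 2 + 1 / Real.log (1 / η)) * Real.log (k / δ) =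
      150 * (Real.log (k / δ) / Real.log 2 + Real.log (k / δ) / Real.log (1 / η)) := by ring
  rw [h3]
  linarith

lemma log_div_div_le {η ε : ℝ} (hη : 0 < η) (hη1 : η < 1) (hε : 0 < ε) (hεη : ε ≤ η) :
    Real.log (1 / (ε / 6 / 16)) ≤
      (Real.log 96 / Real.log (1 / η) + 1) * Real.log (1 / ε) := by
  have hlη : 0 < Real.log (1 / η) := Real.log_pos (by rw [lt_div_iff₀ hη]; linarith)
  have hl : Real.log (1 / η) ≤ Real.log (1 / ε) :=
    Real.log_le_log (by positivity) (one_div_le_one_div_of_le hε hεη)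
  have h96 : 0 ≤ Real.log 96 := Real.log_nonneg (by norm_num)
  have h1 : 1 / (ε / 6 / 16) = 96 * (1 / ε) := by field_simp; norm_num
  rw [h1, Real.log_mul (by norm_num) (by positivity), add_mul, one_mul, div_mul_eq_mul_div]
  gcongr
  rw [le_div_iff₀ hlη]
  gcongr

theorem numSamplesR2_le {C₁ C₂ η : ℝ} (hC₁ : 0 ≤ C₁) (hC₂ : 0 ≤ C₂) (hη : 0 < η) (hη1 : η < 1) :
    ∃ C : ℝ, 0 < C ∧ ∀ (d k : ℕ) (ε δ : ℝ), 1 ≤ k → 0 < ε → ε ≤ η → 0 < δ → δ < 1 → δ ≤ η * k →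
      (numSamplesR2 C₁ C₂ d k ε δ : ℝ) ≤
        C * (1 / ε * Real.log (k / δ) * (d * Real.log (1 / ε) + k + Real.log (1 / δ))) := by
  have hlη : 0 < Real.log (1 / η) := Real.log_pos (by rw [lt_div_iff₀ hη]; linarith)
  have hl2 := Real.log_pos one_lt_two
  have h96 : 0 ≤ Real.log 96 := Real.log_nonneg (by norm_num)
  set K₁ := 150 * (1 / Real.log 2 + 1 / Real.log (1 / η)) with hK₁
  set K₂ := Real.log 96 / Real.log (1 / η) + 1 with hK₂
  have hK₁0 : 0 < K₁ := by positivity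
  have hK₂0 : 0 < K₂ := by positivity
  refine ⟨K₁ * (96 * C₁ * (K₂ + (4 * K₁ + 1)) + 1 + (6 * C₂ + 1)), by positivity, ?_⟩
  intro d k ε δ hk hε hεη hδ hδ1 hδk
  have hk1 : (1 : ℝ) ≤ k := by exact_mod_cast hk
  have ht := rounds_le hη hη1 hδ hδk
  have hla := log_div_div_le hη hη1 hε hεη
  rw [← hK₁] at ht
  rw [← hK₂] at hla
  have hlε : 0 ≤ Real.log (1 / ε) := Real.log_nonneg (by rw [le_div_iff₀ hε]; linarith)
  have hlδ : 0 ≤ Real.log (1 / δ) := Real.log_nonneg (by rw [le_div_iff₀ hδ]; linarith)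
  have hl : 0 < Real.log (k / δ) := Real.log_pos (one_lt_div_delta hk hδ hδ1)
  have hlk : Real.log (k / δ) ≤ k + Real.log (1 / δ) := by
    rw [div_eq_mul_one_div, Real.log_mul (by positivity) (by positivity)]
    linarith [Real.log_le_sub_one_of_pos (by positivity : (0 : ℝ) < k)]
  have htpos : (0 : ℝ) < rounds k δ := by
    have := ceil_logb_pos hk hδ hδ1
    rw [rounds]
    positivity
  set A := d * Real.log (1 / ε) + k + Real.log (1 / δ) with hA
  have hd : 0 ≤ d * Real.log (1 / ε) := by positivity
  have hA1 : 1 ≤ A := by linarith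
  -- The crude bound `ln (4 t) ≤ 4 t` suffices: `t` is at most `K₁ ln (k / δ)`, and `ln (k / δ) ≤ k
  -- + ln (1 / δ) ≤ A`.
  have hlδ' : Real.log (1 / (δ / (4 * rounds k δ))) ≤ (4 * K₁ + 1) * A := by
    have h1 : 1 / (δ / (4 * rounds k δ)) = 4 * rounds k δ * (1 / δ) := by field_simp
    rw [h1, Real.log_mul (by positivity) (by positivity)]
    have h2 := Real.log_le_sub_one_of_pos (by positivity : (0 : ℝ) < 4 * rounds k δ)
    have h3 : K₁ * Real.log (k / δ) ≤ K₁ * A := by gcongr; linarith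
    linarith
  have hmix : (mixSize C₁ d k ε δ : ℝ) ≤ (96 * C₁ * (K₂ + (4 * K₁ + 1)) + 1) * (A / ε) := by
    have hdl : d * Real.log (1 / (ε / 6 / 16)) ≤ K₂ * A := by
      calc d * Real.log (1 / (ε / 6 / 16)) ≤ d * (K₂ * Real.log (1 / ε)) := by gcongr
        _ = K₂ * (d * Real.log (1 / ε)) := by ring
        _ ≤ K₂ * A := by gcongr; linarith
    have hceil : ∀ x y : ℝ, 0 ≤ y → x ≤ y → (⌈x⌉₊ : ℝ) ≤ y + 1 := fun x y hy hxy => by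
      calc (⌈x⌉₊ : ℝ) ≤ ⌈y⌉₊ := by exact_mod_cast Nat.ceil_mono hxy
        _ ≤ y + 1 := (Nat.ceil_lt_add_one hy).le
    have hAε : 1 ≤ A / ε := by rw [le_div_iff₀ hε]; linarith
    refine (hceil _ (96 * C₁ * (K₂ + (4 * K₁ + 1)) * (A / ε)) (by positivity) ?_).trans
      (by linarith)
    calc C₁ / (ε / 6 / 16) * (d * Real.log (1 / (ε / 6 / 16)) +
          Real.log (1 / (δ / (4 * rounds k δ)))) ≤
          C₁ / (ε / 6 / 16) * (K₂ * A + (4 * K₁ + 1) * A) := by gcongr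
      _ = _ := by field_simp; ring
  have htest : (k * testSize C₂ ε : ℝ) ≤ (6 * C₂ + 1) * (A / ε) := by
    have h1 : (testSize C₂ ε : ℝ) ≤ C₂ / (ε / 6) + 1 :=
      (Nat.ceil_lt_add_one (by positivity)).le
    have h2 : C₂ / (ε / 6) + 1 ≤ (6 * C₂ + 1) / ε := by
      rw [le_div_iff₀ hε]
      have : (C₂ / (ε / 6) + 1) * ε = 6 * C₂ + ε := by field_simp
      linarith
    calc (k * testSize C₂ ε : ℝ) ≤ A * ((6 * C₂ + 1) / ε) := by
          gcongr
          · linarith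
          · exact h1.trans h2
      _ = _ := by ring
  rw [numSamplesR2]
  push_cast
  calc (rounds k δ * (mixSize C₁ d k ε δ + k * testSize C₂ ε) : ℝ) ≤
        K₁ * Real.log (k / δ) * ((96 * C₁ * (K₂ + (4 * K₁ + 1)) + 1) * (A / ε) +
          (6 * C₂ + 1) * (A / ε)) := by gcongr
    _ = _ := by ring

end AlgorithmR2

end CollabPAC

theorem theorem2 :
    ∃ C₀ : ℝ, 0 < C₀ ∧ ∀ C₁ : ℝ, C₀ ≤ C₁ → ∀ C₂ : ℝ, 148 ≤ C₂ →
      (∀ (X : Type*) [MeasurableSpace X] (F : Set (X → Bool)) (d : ℕ) (O : CollabPAC.Oracle X)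
          (k : ℕ) (D : Fin k → Measure (X × Bool)) (ε δ : ℝ),
        CollabPAC.vcDim F = d →
        CollabPAC.IsERM F O →
        CollabPAC.IsMeasurableOracle O →
        1 ≤ k →
        (∀ i, IsProbabilityMeasure (D i)) →
        CollabPAC.Realizable F D →
        0 < ε → ε < 1 → 0 < δ → δ < 1 →
        ENNReal.ofReal (1 - δ) ≤
          CollabPAC.lawR2 C₁ C₂ d O D ε δ
            {h | ∀ i, CollabPAC.err (D i) (CollabPAC.output O h) ≤ ε}) ∧
      (∀ η : ℝ, 0 < η → η < 1 → ∃ C : ℝ, 0 < C ∧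
        ∀ (d k : ℕ) (ε δ : ℝ), 1 ≤ k → 0 < ε → ε ≤ η → 0 < δ → δ < 1 → δ ≤ η * k →
          (CollabPAC.numSamplesR2 C₁ C₂ d k ε δ : ℝ) ≤
            C * (1 / ε * Real.log (k / δ) *
              (d * Real.log (1 / ε) + k + Real.log (1 / δ)))) := by
  -- `50` is the constant of the PAC bound `measure_err_lt_le`.
  refine ⟨50, by norm_num, fun C₁ hC₁ C₂ hC₂ => ⟨?_, fun η hη hη1 =>
    CollabPAC.numSamplesR2_le (by linarith) (by linarith) hη hη1⟩⟩
  intro X _ F d O k D ε δ hF hO hOm hk hD hreal hε hε1 hδ hδ1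
  exact CollabPAC.lawR2_ge hC₁ hC₂ hF hO hOm hk hD hreal hε hε1 hδ hδ1
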